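/- Let $H$ be a complex Hilbert space and let $T$ be a bounded linear operator on $H$. Assume: (i) $T$ is in the Cowen–Douglas class $B_n(\mathbb D)$ of the open unit disc $\mathbb D$ for some natural number $n$: for every $z\in\mathbb D$, the number $\bar z$ is an eigenvalue of $T$, the range of $T-\bar z$ is closed, and the eigenspace $\ker(T-\bar z)$ has dimension $n$; moreover the linear span of all the eigenspaces $\ker(T-\bar z)$, $z\in\mathbb D$, is dense in $H$; (ii) $T$ is homogeneous: the spectrum of $T$ is contained in the closed unit disc, and for every Möbius automorphism $g(z)=\dfrac{az+b}{\bar b z+\bar a}$ of $\mathbb D$ ($a,b\in\mathbb C$, $|a|^2-|b|^2=1$) the operator $g(T)=(aT+b)(\bar bT+\bar a)^{-1}$ is unitarily equivalent to $T$. Then $T$ is either similar to a contraction or not power bounded (exactly one of the two alternatives holds); here $T$ is similar to a contraction if $\|XTX^{-1}\|\le 1$ for some bounded invertible operator $X$ on $H$ with bounded inverse, and $T$ is power bounded if $\sup_{k\ge 0}\|T^k\|<\infty$. In particular, if $T$ is polynomially bounded, that is, if there is a constant $C$ with $\|p(T)\|\le C\sup_{|z|\le 1}|p(z)|$ for all complex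 polynomials $p$, then $T$ is similar to a contraction. -/

import Mathlib

open scoped ComplexConjugate

namespace HomogeneousCD

variable {H : Type*} [NormedAddCommGroup H] [InnerProductSpace ℂ H] [CompleteSpace H]

/-- The operator `g(T) = (a T + b) (b̄ T + ā)⁻¹` for the map `g(z) = (a z + b) / (b̄ z + ā)`.
When `|a|² - |b|² = 1` (so that `g` is a Möbius automorphism of the unit disc, and every
automorphism has this form) and the spectrum of `T` lies in the closed unit disc, `g` is
holomorphic near the spectrum, the second factor is invertible (`isUnit_mobius_denominator`),
and this is the value at `g` of the holomorphic functional calculus of `T`. -/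
noncomputable def mobius (a b : ℂ) (T : H →L[ℂ] H) : H →L[ℂ] H :=
  (a • T + b • 1) * Ring.inverse (conj b • T + conj a • 1)

theorem isUnit_mobius_denominator {H : Type*} [NormedAddCommGroup H] [InnerProductSpace ℂ H]
    {T : H →L[ℂ] H} (hT : spectrum ℂ T ⊆ Metric.closedBall 0 1)
    {a b : ℂ} (hab : ‖a‖ ^ 2 - ‖b‖ ^ 2 = 1) :
    IsUnit (conj b • T + conj a • (1 : H →L[ℂ] H)) := by
  have ha : a ≠ 0 := by
    rintro rfl
    have := sq_nonneg ‖b‖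
    simp at hab
    linarith
  by_cases hb : b = 0
  · subst hb
    have : conj (0 : ℂ) • T + conj a • (1 : H →L[ℂ] H)
        = algebraMap ℂ (H →L[ℂ] H) (conj a) := by
      simp [Algebra.algebraMap_eq_smul_one]
    rw [this]
    exact (IsUnit.mk0 _ (by simpa using ha)).map _
  · have hb' : conj b ≠ 0 := by simpa using hb
    have hnot : -(conj a / conj b) ∉ spectrum ℂ T := by
      intro h
      have h1 := hT h
      rw [mem_closedBall_zero_iff, norm_neg, norm_div, RCLike.norm_conj, RCLike.norm_conj,
        div_le_one (norm_pos_iff.2 hb)] at h1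
      nlinarith [norm_nonneg a, norm_nonneg b]
    have h2 := spectrum.notMem_iff.1 hnot
    have h3 : conj b • T + conj a • (1 : H →L[ℂ] H)
        = algebraMap ℂ (H →L[ℂ] H) (-conj b)
          * (algebraMap ℂ (H →L[ℂ] H) (-(conj a / conj b)) - T) := by
      simp only [Algebra.algebraMap_eq_smul_one, smul_mul_assoc, one_mul, smul_sub, smul_smul]
      rw [show -conj b * -(conj a / conj b) = conj a by field_simp]
      simp [add_comm]
    rw [h3]
    exact ((IsUnit.mk0 _ (neg_ne_zero.2 hb')).map _).mul h2

/-- `T` is homogeneous: its spectrum is contained in the closed unit disc and `g(T)` is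
unitarily equivalent to `T` for every Möbius automorphism `g` of the unit disc. -/
def IsHomogeneous (T : H →L[ℂ] H) : Prop :=
  spectrum ℂ T ⊆ Metric.closedBall 0 1 ∧
    ∀ a b : ℂ, ‖a‖ ^ 2 - ‖b‖ ^ 2 = 1 →
      ∃ U ∈ unitary (H →L[ℂ] H), star U * T * U = mobius a b T

/-- The Cowen-Douglas class `B_n(Ω)`, indexed by conjugate eigenvalues: for every `z ∈ Ω`, the
number `z̄` is an eigenvalue of `T`, the range of `T - z̄` is closed and the eigenspace has
(finite) dimension `n`; moreover the eigenspaces together span a dense subspace of `H`. -/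
structure IsCowenDouglas (n : ℕ) (Ω : Set ℂ) (T : H →L[ℂ] H) : Prop where
  hasEigenvalue : ∀ z ∈ Ω, Module.End.HasEigenvalue (T : H →ₗ[ℂ] H) (conj z)
  isClosed_range : ∀ z ∈ Ω, IsClosed (Set.range (T - conj z • (1 : H →L[ℂ] H)))
  rank_eigenspace : ∀ z ∈ Ω,
    Module.rank ℂ (Module.End.eigenspace (T : H →ₗ[ℂ] H) (conj z)) = n
  dense_span : Dense
    ((⨆ z ∈ Ω, Module.End.eigenspace (T : H →ₗ[ℂ] H) (conj z) : Submodule ℂ H) : Set H)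

/-- `T` is similar to a contraction. -/
def IsSimilarToContraction (T : H →L[ℂ] H) : Prop :=
  ∃ X : (H →L[ℂ] H)ˣ, ‖(X : H →L[ℂ] H) * T * ((X⁻¹ : (H →L[ℂ] H)ˣ) : H →L[ℂ] H)‖ ≤ 1

/-- `T` is power bounded. -/
def IsPowerBounded (T : H →L[ℂ] H) : Prop :=
  ∃ C : ℝ, ∀ k : ℕ, ‖T ^ k‖ ≤ C

/-- `T` is polynomially bounded: `‖p(T)‖ ≤ C * sup {|p(z)| : |z| ≤ 1}` for all polynomials `p`,
with `C` independent of `p`. -/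
def IsPolynomiallyBounded (T : H →L[ℂ] H) : Prop :=
  ∃ C : ℝ, ∀ p : Polynomial ℂ,
    ‖Polynomial.aeval T p‖ ≤ C * sSup ((fun z : ℂ => ‖p.eval z‖) '' Metric.closedBall 0 1)

end HomogeneousCD

/-! The argument lives on the generalised kernel V of T, the union of the ker T^k (`nilSpace`). V is
dense, because eigenvectors depend holomorphically on the eigenvalue
(`IsCowenDouglas.dense_nilSpace`), and each ker T^k is finite-dimensional, so spectral theory on V
is linear algebra.

Homogeneity is used for two automorphisms only. An irrational rotation gives a symmetric grading D
of V with [D, T] = -T. Conjugating the closure of D by the unitary of one small hyperbolic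
automorphism gives, after rescaling, a symmetric X with [X, T] = 1 + T². No continuous
representation of the Möbius group is needed: D and X are corrected by operators that commute with T
and whose adjoints do too. These form a finite-dimensional star-algebra, and the correction produces
a copy of sl₂ with D symmetric and B adjoint to L (`exists_sl2_triple`).

Unitarity splits V into finitely many orthogonal lowest weight modules of weights η > 0. The vectors
L^k v / (2η)_k have squared norm k!/(2η)_k ‖v‖², as z^k has in a weighted Bergman space. The
operator z = -T* need not be the shift on these vectors, but Y = L - 2zD carries lowest weight
vectors to lowest weight vectors one step higher. Binomial triangular formulas
(`weightVector_eq_sum`, `z_pow_eq_sum`) then link the orbits z^k v to the weight vectors. Only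
finitely many Y^j survive, so both changes of basis are bounded, and z is similar to an orthogonal
sum of Bergman shifts.

If every η ≥ 1/2, these shifts are contractions (`exists_similarity`). If some η < 1/2, then z^k v
has the k-th weight vector as an orthogonal component. Its norm is unbounded in k, so T is not power
bounded (`exists_lt_norm_z_pow`). -/

namespace HomogeneousCD

/-! ### Formal adjoints, the star-commutant, and the construction of sl₂ -/

section Algebraic

variable {E : Type*} [NormedAddCommGroup E] [InnerProductSpace ℂ E]

/-- `B` is a formal adjoint of `A` on a pre-Hilbert space. -/
def FormalAdj (A B : Module.End ℂ E) : Prop :=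
  ∀ x y, inner ℂ (A x) y = inner ℂ x (B y)

namespace FormalAdj

variable {A B A' B' : Module.End ℂ E}

theorem symm (h : FormalAdj A B) : FormalAdj B A := fun x y => by
  rw [← inner_conj_symm, ← h y x, inner_conj_symm]

theorem add (h : FormalAdj A B) (h' : FormalAdj A' B') : FormalAdj (A + A') (B + B') :=
  fun x y => by rw [LinearMap.add_apply, LinearMap.add_apply, inner_add_left, inner_add_right, h, h']

theorem sub (h : FormalAdj A B) (h' : FormalAdj A' B') : FormalAdj (A - A') (B - B') :=
  fun x y => by rw [LinearMap.sub_apply, LinearMap.sub_apply, inner_sub_left, inner_sub_right, h, h']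

theorem neg (h : FormalAdj A B) : FormalAdj (-A) (-B) :=
  fun x y => by simp [h x y]

theorem mul (h : FormalAdj A B) (h' : FormalAdj A' B') : FormalAdj (A * A') (B' * B) :=
  fun x y => by simp [h _ y, h' x _]

theorem smul (c : ℂ) (h : FormalAdj A B) : FormalAdj (c • A) (conj c • B) :=
  fun x y => by 
    rw [LinearMap.smul_apply, LinearMap.smul_apply, inner_smul_left, inner_smul_right, h]

theorem smul_real (c : ℝ) (h : FormalAdj A B) : FormalAdj ((c : ℂ) • A) ((c : ℂ) • B) := by
  simpa using h.smul (c : ℂ)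

theorem one : FormalAdj (1 : Module.End ℂ E) 1 := fun _ _ => rfl

theorem zero : FormalAdj (0 : Module.End ℂ E) 0 := fun _ _ => by simp

theorem bracket (h : FormalAdj A B) (h' : FormalAdj A' B') :
    FormalAdj (A * A' - A' * A) (B' * B - B * B') := (h.mul h').sub (h'.mul h)

theorem unique (h : FormalAdj A B) (h' : FormalAdj A B') : B = B' :=
  LinearMap.ext fun y => ext_inner_left ℂ fun x => by rw [← h x y, ← h' x y]

theorem eq_of_eq (h : FormalAdj A B) (h' : FormalAdj A' B') (e : A = A') : B = B' :=
  h.unique (e ▸ h')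

end FormalAdj

/-- The operators which commute with `T` and have a formal adjoint commuting with `T`. -/
def starCommutant (T : Module.End ℂ E) : Submodule ℂ (Module.End ℂ E) where
  carrier := {a | a * T = T * a ∧ ∃ b, FormalAdj a b ∧ b * T = T * b}
  add_mem' := by
    rintro a a' ⟨h, b, hb, hb'⟩ ⟨h', c, hc, hc'⟩
    exact ⟨by rw [add_mul, mul_add, h, h'], b + c, hb.add hc, by rw [add_mul, mul_add, hb', hc']⟩
  zero_mem' := ⟨by simp, 0, FormalAdj.zero, by simp⟩
  smul_mem' := by
    rintro c a ⟨h, b, hb, hb'⟩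
    exact ⟨by rw [smul_mul_assoc, mul_smul_comm, h], conj c • b, hb.smul c,
      by rw [smul_mul_assoc, mul_smul_comm, hb']⟩

theorem mem_starCommutant_of_symm {T a : Module.End ℂ E} (h : a * T = T * a)
    (ha : FormalAdj a a) : a ∈ starCommutant T := ⟨h, a, ha, h⟩

theorem mem_starCommutant_adj {T a b : Module.End ℂ E} (h : a ∈ starCommutant T)
    (hab : FormalAdj a b) : b ∈ starCommutant T := by
  obtain ⟨h1, c, hc, hc'⟩ := h
  obtain rfl := hab.unique hc
  exact ⟨hc', a, hc.symm, h1⟩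

theorem mul_mem_starCommutant {T a b : Module.End ℂ E} (ha : a ∈ starCommutant T)
    (hb : b ∈ starCommutant T) : a * b ∈ starCommutant T := by
  obtain ⟨h1, c, hc, hc'⟩ := ha
  obtain ⟨h2, d, hd, hd'⟩ := hb
  refine ⟨by rw [mul_assoc, h2, ← mul_assoc, h1, mul_assoc], d * c, hc.mul hd, ?_⟩
  rw [mul_assoc, hc', ← mul_assoc, hd', mul_assoc]

/-- Induct on the nilpotency order of x. If a(Tx) = 0, then ax and a*ax both lie in ker T, so aa*ax
= 0; positivity gives a*ax = 0 and then ax = 0. Hence restriction to ker T is faithful on the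
star-commutant, which is therefore finite-dimensional. -/
theorem eq_zero_of_forall_ker_eq_zero {T a : Module.End ℂ E}
    (hnil : ∀ x, ∃ k : ℕ, (T ^ k) x = 0) (ha : a ∈ starCommutant T)
    (h0 : ∀ x, T x = 0 → a x = 0) : a = 0 := by
  obtain ⟨h1, b, hb, hb'⟩ := ha
  have key : ∀ k : ℕ, ∀ x, (T ^ k) x = 0 → a x = 0 := by
    intro k
    induction k with
    | zero => intro x hx; have : x = 0 := by simpa using hx
              simp [this]
    | succ k ih =>
      intro x hx
      have hTx : a (T x) = 0 := ih _ (by simpa [pow_succ] using hx)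
      have hTa : T (a x) = 0 := by
        rw [← Module.End.mul_apply, ← h1, Module.End.mul_apply, hTx]
      have hb0 : ∀ y, T y = 0 → T (b y) = 0 := fun y hy => by
        rw [← Module.End.mul_apply, ← hb', Module.End.mul_apply, hy, map_zero]
      have : a (b (a x)) = 0 := h0 _ (hb0 _ hTa)
      have h2 : b (a x) = 0 := by
        rw [← inner_self_eq_zero (𝕜 := ℂ), ← hb, this, inner_zero_left]
      rw [← inner_self_eq_zero (𝕜 := ℂ), hb, h2, inner_zero_right]
  ext x
  obtain ⟨k, hk⟩ := hnil x
  exact key k x hk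

/-- If `ad D` maps into the commutant, then `D` can be corrected by an element of the
commutant so that it commutes with the whole commutant. -/
theorem exists_sub_commute_starCommutant {T D : Module.End ℂ E}
    [FiniteDimensional ℂ (LinearMap.ker T)] (hnil : ∀ x, ∃ k : ℕ, (T ^ k) x = 0)
    (hD : FormalAdj D D) (hDT : D * T - T * D = -T) :
    ∃ a ∈ starCommutant T, FormalAdj a a ∧
      ∀ c ∈ starCommutant T, c * (D - a) = (D - a) * c := by
  have hpres : ∀ a : starCommutant T, ∀ x ∈ LinearMap.ker T, a.1 x ∈ LinearMap.ker T := by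
    intro a x hx
    rw [LinearMap.mem_ker] at hx ⊢
    rw [← Module.End.mul_apply, ← a.2.1, Module.End.mul_apply, hx, map_zero]
  have hDpres : ∀ x ∈ LinearMap.ker T, D x ∈ LinearMap.ker T := by
    intro x hx
    rw [LinearMap.mem_ker] at hx ⊢
    have := LinearMap.congr_fun hDT x
    simp [hx] at this
    simpa using this
  let ρ : starCommutant T →ₗ[ℂ] Module.End ℂ (LinearMap.ker T) :=
    { toFun := fun a => a.1.restrict (hpres a)
      map_add' := fun a b => by ext; simp
      map_smul' := fun c a => by ext; simp }
  let D₀ : Module.End ℂ (LinearMap.ker T) := D.restrict hDpres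
  have hρinj : ∀ a, ρ a = 0 → a = 0 := by
    intro a ha
    apply Subtype.ext
    refine eq_zero_of_forall_ker_eq_zero hnil a.2 fun x hx => ?_
    have := LinearMap.congr_fun ha ⟨x, hx⟩
    simpa [ρ] using congrArg Subtype.val this
  have hfin : FiniteDimensional ℂ (starCommutant T) :=
    FiniteDimensional.of_injective ρ ((injective_iff_map_eq_zero ρ).2 hρinj)
  -- The trace form on ker T is nondegenerate: pairing a with its adjoint gives the squared
  -- Hilbert–Schmidt norm of a on ker T.
  have hpos : ∀ a : starCommutant T,
      (∀ b, LinearMap.trace ℂ _ (ρ b * ρ a) = 0) → a = 0 := by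
    intro a ha
    obtain ⟨b, hb, -⟩ := a.2.2
    have hb' : b ∈ starCommutant T := mem_starCommutant_adj a.2 hb
    have h1 := ha ⟨b, hb'⟩
    let e := stdOrthonormalBasis ℂ (LinearMap.ker T)
    rw [LinearMap.trace_eq_sum_inner _ e] at h1
    have h2 : ∀ i, inner ℂ (e i) ((ρ ⟨b, hb'⟩ * ρ a) (e i)) = ((‖ρ a (e i)‖ ^ 2 : ℝ) : ℂ) := by
      intro i
      have h4 : inner ℂ (e i) ((ρ ⟨b, hb'⟩ * ρ a) (e i)) = inner ℂ (ρ a (e i)) (ρ a (e i)) :=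
        (hb (e i) (a.1 (e i))).symm
      rw [h4, inner_self_eq_norm_sq_to_K]
      norm_num
    rw [Finset.sum_congr rfl fun i _ => h2 i, ← Complex.ofReal_sum, Complex.ofReal_eq_zero,
      Finset.sum_eq_zero_iff_of_nonneg (fun i _ => by positivity)] at h1
    refine hρinj a (e.toBasis.ext fun i => ?_)
    simpa using h1 i (Finset.mem_univ i)
  let Φ : starCommutant T →ₗ[ℂ] Module.Dual ℂ (starCommutant T) :=
    LinearMap.mk₂ ℂ (fun a b => LinearMap.trace ℂ _ (ρ b * ρ a))
      (fun a a' b => by simp [mul_add]) (fun c a b => by simp)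
      (fun a b b' => by simp [add_mul]) (fun c a b => by simp)
  have hΦinj : Function.Injective Φ := (injective_iff_map_eq_zero Φ).2 fun a ha =>
    hpos a fun b => by simpa [Φ] using LinearMap.congr_fun ha b
  have hΦsurj : Function.Surjective Φ :=
    (LinearMap.injective_iff_surjective_of_finrank_eq_finrank
      (Subspace.dual_finrank_eq).symm).1 hΦinj
  let ℓ : Module.Dual ℂ (starCommutant T) :=
    { toFun := fun b => LinearMap.trace ℂ _ (ρ b * D₀)
      map_add' := fun b b' => by simp [add_mul]
      map_smul' := fun c b => by simp }
  -- Represent b ↦ tr(bD) by an element a₀ of the commutant, so that D - a₀ is trace-orthogonal to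
  -- all of it.
  obtain ⟨a₀, ha₀⟩ := hΦsurj ℓ
  have htr : ∀ b, LinearMap.trace ℂ _ (ρ b * (D₀ - ρ a₀)) = 0 := by
    intro b
    have := LinearMap.congr_fun ha₀ b
    simp only [Φ, ℓ, LinearMap.mk₂_apply, LinearMap.coe_mk, AddHom.coe_mk] at this
    rw [mul_sub, map_sub, this, sub_self]
  -- [c, D - a₀] stays in the star-commutant by the Jacobi identity, and tr(b[c, D - a₀]) = tr([b,
  -- c](D - a₀)) = 0 for every b. Nondegeneracy kills it.
  have hcomm : ∀ c ∈ starCommutant T, c * (D - a₀.1) = (D - a₀.1) * c := by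
    intro c hc
    have hmem : ∀ c, c ∈ starCommutant T → c * (D - a₀.1) - (D - a₀.1) * c ∈ starCommutant T := by
      intro c hc
      obtain ⟨h1, d, hd, hd'⟩ := hc
      obtain ⟨h2, e, he, he'⟩ := a₀.2
      refine ⟨?_, _, hd.bracket (hD.sub he), ?_⟩
      · linear_combination (norm := noncomm_ring) c * hDT + h1 * D - D * h1 - hDT * c - h1
          - c * h2 - h1 * a₀.1 + h2 * c + a₀.1 * h1
      · linear_combination (norm := noncomm_ring) - d * hDT - hd' * D + D * hd' + hDT * d + hd'
          + d * he' + hd' * e - he' * d - e * hd'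
    have h0 : (⟨_, hmem c hc⟩ : starCommutant T) = 0 := by
      apply hpos
      intro b
      have h3 : ρ ⟨_, hmem c hc⟩ = ρ ⟨c, hc⟩ * (D₀ - ρ a₀) - (D₀ - ρ a₀) * ρ ⟨c, hc⟩ := by
        ext x; simp [ρ, D₀]
      have h4 : b.1 * c - c * b.1 ∈ starCommutant T :=
        Submodule.sub_mem _ (mul_mem_starCommutant b.2 hc) (mul_mem_starCommutant hc b.2)
      have h5 := htr ⟨_, h4⟩
      have h6 : ρ ⟨_, h4⟩ = ρ b * ρ ⟨c, hc⟩ - ρ ⟨c, hc⟩ * ρ b := by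
        ext x; simp [ρ]
      rw [h6, sub_mul, map_sub] at h5
      rw [h3, mul_sub, map_sub, ← mul_assoc, ← mul_assoc,
        LinearMap.trace_mul_comm ℂ (ρ b * (D₀ - ρ a₀)), ← mul_assoc]
      exact h5
    exact sub_eq_zero.1 (congrArg Subtype.val h0)
  obtain ⟨b, hb, hb'⟩ := a₀.2.2
  have hbm : b ∈ starCommutant T := mem_starCommutant_adj a₀.2 hb
  have hcomm' : ∀ c ∈ starCommutant T, c * (D - b) = (D - b) * c := by
    intro c hc
    obtain ⟨-, d, hd, -⟩ := id hc
    have := hcomm d (mem_starCommutant_adj hc hd)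
    exact (((hD.sub hb).mul hd.symm).eq_of_eq (hd.symm.mul (hD.sub hb)) this.symm)
  -- The adjoint b of a₀ is an equally good correction, and the average of the two is symmetric.
  refine ⟨(((1 / 2 : ℝ) : ℝ) : ℂ) • (a₀.1 + b),
    Submodule.smul_mem _ _ (Submodule.add_mem _ a₀.2 hbm), ?_, ?_⟩
  · have := (hb.add hb.symm).smul_real (1 / 2)
    rwa [add_comm b] at this
  · intro c hc
    have e1 : D - (((1 / 2 : ℝ) : ℝ) : ℂ) • (a₀.1 + b)
        = (((1 / 2 : ℝ) : ℝ) : ℂ) • ((D - a₀.1) + (D - b)) := by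
      ext x; simp; module
    rw [e1, mul_smul_comm, smul_mul_assoc, mul_add, add_mul, hcomm c hc, hcomm' c hc]

/-- A symmetric grading operator and a symmetric generator of a hyperbolic flow can be
corrected by elements of the commutant so as to span a copy of `sl₂`. -/
theorem exists_sl2_triple {T D X : Module.End ℂ E}
    [FiniteDimensional ℂ (LinearMap.ker T)] (hnil : ∀ x, ∃ k : ℕ, (T ^ k) x = 0)
    (hD : FormalAdj D D) (hX : FormalAdj X X) (hDT : D * T - T * D = -T)
    (hXT : X * T - T * X = 1 + T * T) :
    ∃ D' L B : Module.End ℂ E, FormalAdj D' D' ∧ FormalAdj L B ∧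
      D' * T - T * D' = -T ∧ L * T - T * L = 1 ∧ B * T - T * B = T * T ∧
      D' * L - L * D' = L ∧ D' * B - B * D' = -B ∧ B * L - L * B = (2 : ℂ) • D' := by
  obtain ⟨a, ha, haa, hcomm⟩ := exists_sub_commute_starCommutant hnil hD hDT
  obtain ⟨D₁, hD₁⟩ : ∃ D₁, D₁ = D - a := ⟨_, rfl⟩
  rw [← hD₁] at hcomm
  have hs : FormalAdj D₁ D₁ := hD₁ ▸ hD.sub haa
  have hT₁ : D₁ * T - T * D₁ = -T := by
    have := ha.1
    rw [hD₁]
    linear_combination (norm := noncomm_ring) hDT - this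
  obtain ⟨Y, hY⟩ : ∃ Y, Y = D₁ * X - X * D₁ := ⟨_, rfl⟩
  have hYT : Y * T - T * Y = 1 - T * T := by
    rw [hY]
    linear_combination (norm := noncomm_ring) D₁ * hXT - hXT * D₁ - X * hT₁ + hT₁ * X
      + hT₁ * T + T * hT₁ + hXT
  have hYa : FormalAdj Y (-Y) := by
    have := hs.bracket hX
    rw [hY, neg_sub]
    exact this
  -- X₂ is the double bracket of X with D₁. It has the same bracket with T as X, so X₂ - X lies in
  -- the star-commutant and commutes with D₁. Thus ad D₁ exchanges X₂ and Y, and the half sum and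
  -- half difference of X₂ and Y have weights 1 and -1.
  obtain ⟨X₂, hX₂⟩ : ∃ X₂, X₂ = D₁ * Y - Y * D₁ := ⟨_, rfl⟩
  have hX₂T : X₂ * T - T * X₂ = 1 + T * T := by
    rw [hX₂]
    linear_combination (norm := noncomm_ring) D₁ * hYT - hYT * D₁ - Y * hT₁ + hT₁ * Y
      - hT₁ * T - T * hT₁ + hYT
  have hX₂a : FormalAdj X₂ X₂ := by
    have := hs.bracket hYa
    rw [hX₂]
    convert this using 1
    noncomm_ring
  have hW : X₂ - X ∈ starCommutant T := by
    refine mem_starCommutant_of_symm ?_ (hX₂a.sub hX)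
    linear_combination (norm := noncomm_ring) hX₂T - hXT
  have hWD := hcomm _ hW
  have hDX₂ : D₁ * X₂ - X₂ * D₁ = Y := by
    rw [hY]
    linear_combination (norm := noncomm_ring) -hWD
  have hL : ∃ L B : Module.End ℂ E, FormalAdj L B ∧ L * T - T * L = 1 ∧
      B * T - T * B = T * T ∧ D₁ * L - L * D₁ = L ∧ D₁ * B - B * D₁ = -B := by
    have two : ∀ A : Module.End ℂ E, (((1 / 2 : ℝ) : ℝ) : ℂ) • (A + A) = A := by
      intro A; rw [← two_smul ℂ A, smul_smul]; norm_num
    refine ⟨(((1 / 2 : ℝ) : ℝ) : ℂ) • (X₂ + Y), (((1 / 2 : ℝ) : ℝ) : ℂ) • (X₂ - Y),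
      ?_, ?_, ?_, ?_, ?_⟩
    · have := (hX₂a.add hYa).smul_real (1 / 2)
      rwa [← sub_eq_add_neg] at this
    · rw [smul_mul_assoc, mul_smul_comm, ← smul_sub]
      conv_rhs => rw [← two 1]
      congr 1
      linear_combination (norm := noncomm_ring) hX₂T + hYT
    · rw [smul_mul_assoc, mul_smul_comm, ← smul_sub]
      conv_rhs => rw [← two (T * T)]
      congr 1
      linear_combination (norm := noncomm_ring) hX₂T - hYT
    · rw [smul_mul_assoc, mul_smul_comm, ← smul_sub]
      congr 1
      linear_combination (norm := noncomm_ring) hDX₂ - hX₂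
    · rw [smul_mul_assoc, mul_smul_comm, ← smul_sub, ← smul_neg]
      congr 1
      linear_combination (norm := noncomm_ring) hDX₂ + hX₂
  obtain ⟨L, B, hLB, hLT, hBT, hDL, hDB⟩ := hL
  -- Z is the defect in the last sl₂ relation. It commutes with T and is symmetric, so it lies in
  -- the star-commutant.
  obtain ⟨Z, hZ⟩ : ∃ Z, Z = L * B - B * L + D₁ + D₁ := ⟨_, rfl⟩
  have hZa : FormalAdj Z Z := hZ ▸ ((hLB.bracket hLB.symm).add hs).add hs
  have hZT : Z * T = T * Z := by
    rw [hZ]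
    linear_combination (norm := noncomm_ring) L * hBT - hBT * L - B * hLT + hLT * B
      + hLT * T + T * hLT + 2 * hT₁
  have hZm : Z ∈ starCommutant T := mem_starCommutant_of_symm hZT hZa
  have hZD := hcomm _ hZm
  have hZLT : (Z * L - L * Z) * T = T * (Z * L - L * Z) := by
    linear_combination (norm := noncomm_ring) Z * hLT - hLT * Z - L * hZT + hZT * L
  have hBZT : (B * Z - Z * B) * T = T * (B * Z - Z * B) := by
    linear_combination (norm := noncomm_ring) - Z * hBT + hBT * Z + B * hZT - hZT * B
      - hZT * T - T * hZT
  have hZLm : Z * L - L * Z ∈ starCommutant T := ⟨hZLT, _, hZa.bracket hLB, hBZT⟩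
  have hZLD := hcomm _ hZLm
  -- [Z, L] lies in the star-commutant, hence commutes with D₁; but Z commutes with D₁ and L has
  -- weight one, so [D₁, [Z, L]] = [Z, L]. Therefore it vanishes, and Z can be absorbed into D₁.
  have hZL : Z * L = L * Z := by
    linear_combination (norm := noncomm_ring) -hZLD + hZD * L - L * hZD - Z * hDL + hDL * Z
  have hZB : B * Z = Z * B := (hZa.mul hLB).eq_of_eq (hLB.mul hZa) hZL
  refine ⟨D₁ - (((1 / 2 : ℝ) : ℝ) : ℂ) • Z, L, B, hs.sub (hZa.smul_real _), hLB, ?_, hLT, hBT,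
    ?_, ?_, ?_⟩
  · rw [sub_mul, mul_sub, smul_mul_assoc, mul_smul_comm, hZT, ← hT₁]
    abel
  · rw [sub_mul, mul_sub, smul_mul_assoc, mul_smul_comm, hZL]
    linear_combination (norm := abel) hDL
  · rw [sub_mul, mul_sub, smul_mul_assoc, mul_smul_comm, hZB]
    linear_combination (norm := abel) hDB
  · rw [smul_sub, smul_smul, two_smul, hZ]
    norm_num

end Algebraic

end HomogeneousCD

/-! ### Weight spaces of the grading operator -/

namespace HomogeneousCD

section Weights

variable {E : Type*} [NormedAddCommGroup E] [InnerProductSpace ℂ E] {T D : Module.End ℂ E}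

theorem finiteDimensional_ker_pow {E : Type*} [AddCommGroup E] [Module ℂ E] {T : Module.End ℂ E}
    [FiniteDimensional ℂ (LinearMap.ker T)] (k : ℕ) :
    FiniteDimensional ℂ (LinearMap.ker (T ^ k)) := by
  induction k with
  | zero =>
    have : LinearMap.ker (T ^ 0) = ⊥ := by
      rw [pow_zero]; exact LinearMap.ker_eq_bot_of_injective fun _ _ h => h
    rw [this]; infer_instance
  | succ k ih =>
    refine Submodule.fg_iff_finiteDimensional _ |>.1 (Submodule.fg_of_fg_map_of_fg_inf_ker T ?_ ?_)
    · refine (Submodule.fg_iff_finiteDimensional _).2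
        (Submodule.finiteDimensional_of_le (S₂ := LinearMap.ker (T ^ k)) ?_)
      rintro _ ⟨x, hx, rfl⟩
      simpa [pow_succ] using hx
    · exact (Submodule.fg_iff_finiteDimensional _).2
        (Submodule.finiteDimensional_of_le (S₂ := LinearMap.ker T) inf_le_right)

theorem pow_mul_sub_of_bracket_eq_neg (h : D * T - T * D = -T) (k : ℕ) :
    D * T ^ k - T ^ k * D = -(k : ℂ) • T ^ k := by
  induction k with
  | zero => simp
  | succ k ih =>
    rw [pow_succ, Nat.cast_succ, neg_add, add_smul, neg_one_smul]
    have : (-(k : ℂ)) • (T ^ k * T) = ((-(k : ℂ)) • T ^ k) * T := by rw [smul_mul_assoc]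
    rw [this, ← ih]
    linear_combination (norm := noncomm_ring) T ^ k * h

theorem map_mem_ker_pow_of_bracket_eq_neg (h : D * T - T * D = -T) {k : ℕ} {x : E}
    (hx : (T ^ k) x = 0) : (T ^ k) (D x) = 0 := by
  have := LinearMap.congr_fun (pow_mul_sub_of_bracket_eq_neg h k) x
  simpa [hx] using this

/-- A finite-dimensional subspace invariant under a symmetric operator is spanned by the
eigenvectors it contains. -/
theorem le_iSup_eigenspace_inf (hD : FormalAdj D D) (N : Submodule ℂ E)
    [FiniteDimensional ℂ N] (hN : ∀ x ∈ N, D x ∈ N) :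
    N ≤ ⨆ t : ℝ, Module.End.eigenspace D (t : ℂ) ⊓ N := by
  have hsym : (D.restrict hN).IsSymmetric := fun x y => hD x y
  have htop : (⨆ μ : ℂ, Module.End.eigenspace (D.restrict hN) μ) = ⊤ := by
    have := hsym.orthogonalComplement_iSup_eigenspaces_eq_bot
    rwa [Submodule.orthogonal_eq_bot_iff] at this
  have h1 : N = Submodule.map N.subtype (⨆ μ : ℂ, Module.End.eigenspace (D.restrict hN) μ) := by
    rw [htop, Submodule.map_subtype_top]
  conv_lhs => rw [h1]
  rw [Submodule.map_iSup]
  refine iSup_le fun μ => ?_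
  by_cases hμ : Module.End.HasEigenvalue (D.restrict hN) μ
  · have hc := hsym.conj_eigenvalue_eq_self hμ
    obtain ⟨t, rfl⟩ := Complex.conj_eq_iff_real.1 hc
    refine le_trans ?_ (le_iSup _ t)
    rintro _ ⟨x, hx, rfl⟩
    refine ⟨?_, x.2⟩
    rw [SetLike.mem_coe, Module.End.mem_eigenspace_iff] at hx ⊢
    simpa using congrArg Subtype.val hx
  · rw [Module.End.hasEigenvalue_iff, not_not] at hμ
    rw [hμ]; simp

theorem iSup_eigenspace_real_eq_top [FiniteDimensional ℂ (LinearMap.ker T)]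
    (hnil : ∀ x, ∃ k : ℕ, (T ^ k) x = 0)
    (hD : FormalAdj D D) (hDT : D * T - T * D = -T) :
    ⨆ t : ℝ, Module.End.eigenspace D (t : ℂ) = ⊤ := by
  rw [eq_top_iff]
  intro x _
  obtain ⟨k, hk⟩ := hnil x
  have := finiteDimensional_ker_pow (T := T) k
  have h1 := le_iSup_eigenspace_inf hD (LinearMap.ker (T ^ k))
    (fun y hy => map_mem_ker_pow_of_bracket_eq_neg hDT hy) hk
  exact (iSup_mono fun t => inf_le_left : _ ≤ ⨆ t : ℝ, Module.End.eigenspace D (t : ℂ)) h1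

theorem inner_eq_zero_of_eigenspace_ne (hD : FormalAdj D D) {s t : ℝ} (hst : s ≠ t) {x y : E}
    (hx : D x = (s : ℂ) • x) (hy : D y = (t : ℂ) • y) : inner ℂ x y = 0 := by
  have := hD x y
  rw [hx, hy, inner_smul_left, inner_smul_right, Complex.conj_ofReal, ← sub_eq_zero, ← sub_mul,
    mul_eq_zero] at this
  refine this.resolve_left fun h => hst ?_
  exact_mod_cast sub_eq_zero.1 h

/-- The weights of `ker T` are bounded by some `c`; a vector of weight `t` is killed by
`T ^ k` as soon as `t + c < k`. -/
theorem exists_weight_bound [FiniteDimensional ℂ (LinearMap.ker T)]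
    (hnil : ∀ x, ∃ k : ℕ, (T ^ k) x = 0) (hDT : D * T - T * D = -T) :
    ∃ c : ℝ, ∀ (t : ℝ) (x : E), D x = (t : ℂ) • x →
      (∀ k : ℕ, t + c < k → (T ^ k) x = 0) ∧ (T x = 0 → c < t → x = 0) := by
  have hDpres : ∀ x ∈ LinearMap.ker T, D x ∈ LinearMap.ker T := by
    intro x hx
    have := map_mem_ker_pow_of_bracket_eq_neg (k := 1) hDT (by simpa using hx)
    simpa using this
  let D₀ : LinearMap.ker T →L[ℂ] LinearMap.ker T := LinearMap.toContinuousLinearMap (D.restrict hDpres)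
  have hbd : ∀ (s : ℝ) (y : E), T y = 0 → D y = (s : ℂ) • y → y ≠ 0 → |s| ≤ ‖D₀‖ := by
    intro s y hy hDy hy0
    have h1 := D₀.le_opNorm ⟨y, hy⟩
    have h2 : ‖D₀ ⟨y, hy⟩‖ = ‖D y‖ := rfl
    rw [h2, hDy, norm_smul, Complex.norm_real, Real.norm_eq_abs] at h1
    exact le_of_mul_le_mul_right h1 (norm_pos_iff.2 hy0)
  -- The bound is the norm of D on ker T. If T^m x is the last nonzero iterate, it lies in ker T
  -- with weight t - m, so t - m ≥ -c.
  refine ⟨‖D₀‖, fun t x hx => ⟨fun k hk => ?_, fun hT ht => ?_⟩⟩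
  · by_contra hne
    have hex := hnil x
    classical
    obtain ⟨m, hm⟩ : ∃ m, Nat.find hex = m + 1 := by
      refine Nat.exists_eq_succ_of_ne_zero fun h0 => hne ?_
      have := Nat.find_spec hex
      rw [h0] at this
      have hx0 : x = 0 := by simpa using this
      simp [hx0]
    have hkm : k ≤ m := by
      by_contra hlt
      have h1 := Nat.find_spec hex
      rw [hm] at h1
      obtain ⟨j, hj⟩ := Nat.exists_eq_add_of_le (show m + 1 ≤ k by omega)
      apply hne
      rw [hj, add_comm, pow_add, Module.End.mul_apply, h1, map_zero]
    have hmne : (T ^ m) x ≠ 0 := Nat.find_min hex (by omega)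
    have h1 : T ((T ^ m) x) = 0 := by
      have := Nat.find_spec hex
      rw [hm, pow_succ'] at this
      exact this
    have h2 : D ((T ^ m) x) = ((t - m : ℝ) : ℂ) • (T ^ m) x := by
      have := LinearMap.congr_fun (pow_mul_sub_of_bracket_eq_neg hDT m) x
      simp only [LinearMap.sub_apply, Module.End.mul_apply, LinearMap.smul_apply, hx, map_smul] at this
      rw [sub_eq_iff_eq_add] at this
      rw [this, ← add_smul]
      congr 1
      push_cast; ring
    have h3 := abs_le.1 (hbd _ _ h1 h2 hmne)
    have h4 : (k : ℝ) ≤ m := by exact_mod_cast hkm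
    linarith [h3.1]
  · by_contra hne
    have := (abs_le.1 (hbd t x hT hx hne)).2
    linarith

theorem map_eigenspace_of_bracket {A : Module.End ℂ E} {r t : ℝ}
    (hA : D * A - A * D = (r : ℂ) • A) {x : E} (hx : D x = (t : ℂ) • x) :
    D (A x) = ((t + r : ℝ) : ℂ) • A x := by
  have := LinearMap.congr_fun hA x
  simp only [LinearMap.sub_apply, Module.End.mul_apply, LinearMap.smul_apply, hx, map_smul] at this
  rw [sub_eq_iff_eq_add] at this
  rw [this, ← add_smul]
  congr 1
  push_cast; ring

theorem finiteDimensional_eigenspace [FiniteDimensional ℂ (LinearMap.ker T)]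
    (hnil : ∀ x, ∃ k : ℕ, (T ^ k) x = 0) (hDT : D * T - T * D = -T) (t : ℝ) :
    FiniteDimensional ℂ (Module.End.eigenspace D (t : ℂ)) := by
  obtain ⟨c, hc⟩ := exists_weight_bound hnil hDT
  obtain ⟨K, hK⟩ := exists_nat_gt (t + c)
  have := finiteDimensional_ker_pow (T := T) K
  refine Submodule.finiteDimensional_of_le (S₂ := LinearMap.ker (T ^ K)) fun x hx => ?_
  exact (hc t x (Module.End.mem_eigenspace_iff.1 hx)).1 K hK

/-- T lowers weights by one and distinct weight spaces are orthogonal, so for y of weight t the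
functional x ↦ ⟨Tx, y⟩ sees only the component of x of weight t + 1. That space is
finite-dimensional, so the Riesz vector exists inside E although E need not be complete. -/
theorem exists_formalAdj [FiniteDimensional ℂ (LinearMap.ker T)]
    (hnil : ∀ x, ∃ k : ℕ, (T ^ k) x = 0)
    (hD : FormalAdj D D) (hDT : D * T - T * D = -T) : ∃ S, FormalAdj T S := by
  have htop := iSup_eigenspace_real_eq_top hnil hD hDT
  have hbr : D * T - T * D = ((-1 : ℝ) : ℂ) • T := by rw [hDT]; simp
  have key : ∀ y : E, ∃ h : E, ∀ x, inner ℂ (T x) y = inner ℂ x h := by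
    intro y
    have hy : y ∈ ⨆ t : ℝ, Module.End.eigenspace D (t : ℂ) := by rw [htop]; trivial
    induction hy using Submodule.iSup_induction' with
    | zero => exact ⟨0, by simp⟩
    | add y y' _ _ h h' =>
      obtain ⟨u, hu⟩ := h
      obtain ⟨u', hu'⟩ := h'
      exact ⟨u + u', fun x => by rw [inner_add_right, inner_add_right, hu, hu']⟩
    | mem t y hy =>
      rw [Module.End.mem_eigenspace_iff] at hy
      have hfd := finiteDimensional_eigenspace hnil hDT (t + 1)
      let W := Module.End.eigenspace D ((t + 1 : ℝ) : ℂ)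
      let T₀ : W →ₗ[ℂ] E := T ∘ₗ W.subtype
      let φ : W →L[ℂ] ℂ := (innerSL ℂ y).comp (LinearMap.toContinuousLinearMap T₀)
      let h₀ : W := (InnerProductSpace.toDual ℂ W).symm φ
      refine ⟨h₀, fun x => ?_⟩
      have hx : x ∈ ⨆ t : ℝ, Module.End.eigenspace D (t : ℂ) := by rw [htop]; trivial
      induction hx using Submodule.iSup_induction' with
      | zero => simp
      | add x x' _ _ h h' => rw [map_add, inner_add_left, inner_add_left, h, h']
      | mem s x hx =>
        by_cases hs : s = t + 1
        · subst hs
          have h1 : inner ℂ h₀ (⟨x, hx⟩ : W) = φ ⟨x, hx⟩ :=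
            InnerProductSpace.toDual_symm_apply
          have h2 : φ ⟨x, hx⟩ = inner ℂ y (T x) := rfl
          rw [h2] at h1
          have h3 : inner ℂ (h₀ : E) x = inner ℂ y (T x) := h1
          rw [← inner_conj_symm, ← h3, inner_conj_symm]
        · rw [Module.End.mem_eigenspace_iff] at hx
          rw [inner_eq_zero_of_eigenspace_ne hD hs hx (Module.End.mem_eigenspace_iff.1 h₀.2)]
          refine inner_eq_zero_of_eigenspace_ne hD ?_ (map_eigenspace_of_bracket hbr hx) hy
          intro h; apply hs; linarith
  choose S hS using key
  refine ⟨{ toFun := S, map_add' := fun y y' => ?_, map_smul' := fun c y => ?_ }, fun x y => hS y x⟩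
  · exact ext_inner_left ℂ fun x => by
      rw [← hS, inner_add_right, inner_add_right, hS, hS]
  · exact ext_inner_left ℂ fun x => by
      rw [← hS, inner_smul_right, RingHom.id_apply, inner_smul_right, hS]

end Weights

end HomogeneousCD

/-! ### Rising factorials, Bergman weights and a Pascal identity -/

namespace HomogeneousCD

/-- The rising factorial `x (x + 1) ⋯ (x + k - 1)`. -/
noncomputable def poch (x : ℝ) (k : ℕ) : ℝ := ∏ i ∈ Finset.range k, (x + i)

@[simp] theorem poch_zero (x : ℝ) : poch x 0 = 1 := by simp [poch]

theorem poch_succ (x : ℝ) (k : ℕ) : poch x (k + 1) = poch x k * (x + k) := by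
  simp [poch, Finset.prod_range_succ]

theorem poch_succ' (x : ℝ) (k : ℕ) : poch x (k + 1) = x * poch (x + 1) k := by
  simp only [poch, Finset.prod_range_succ']
  rw [mul_comm]
  congr 1
  · simp
  · refine Finset.prod_congr rfl fun i _ => ?_
    push_cast; ring

theorem poch_pos {x : ℝ} (hx : 0 < x) (k : ℕ) : 0 < poch x k :=
  Finset.prod_pos fun i _ => by positivity

theorem poch_add (x : ℝ) (k l : ℕ) : poch x (k + l) = poch x k * poch (x + k) l := by
  simp only [poch, Finset.prod_range_add]
  congr 1
  refine Finset.prod_congr rfl fun i _ => ?_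
  push_cast; ring

theorem pow_le_poch {x y : ℝ} (hy : 0 ≤ y) (hxy : y ≤ x) (k : ℕ) : y ^ k ≤ poch x k := by
  rw [poch, ← Finset.card_range k, ← Finset.prod_const]
  rw [Finset.card_range]
  exact Finset.prod_le_prod (fun _ _ => hy) fun i _ => by
    have : (0 : ℝ) ≤ i := by positivity
    linarith

/-- The square of the norm of `z ^ k` in the weighted Bergman space of weight `2 η`. -/
noncomputable def bergmanWeight (η : ℝ) (k : ℕ) : ℝ := k.factorial / poch (2 * η) k

theorem bergmanWeight_pos {η : ℝ} (hη : 0 < η) (k : ℕ) : 0 < bergmanWeight η k :=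
  div_pos (by positivity) (poch_pos (by linarith) k)

theorem bergmanWeight_succ {η : ℝ} (k : ℕ) :
    bergmanWeight η (k + 1) = bergmanWeight η k * ((k + 1) / (2 * η + k)) := by
  rw [bergmanWeight, bergmanWeight, poch_succ, Nat.factorial_succ, div_mul_div_comm]
  push_cast; ring

theorem bergmanWeight_succ_le {η : ℝ} (hη : 1 / 2 ≤ η) (k : ℕ) :
    bergmanWeight η (k + 1) ≤ bergmanWeight η k := by
  rw [bergmanWeight_succ]
  refine mul_le_of_le_one_right (bergmanWeight_pos (by linarith) k).le ?_
  have : (0 : ℝ) ≤ k := by positivity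
  rw [div_le_one (by linarith)]
  linarith

/-- Consecutive weights have ratio at least 1 + (1 - 2η)/(k + 1), so the weights dominate a positive
multiple of the harmonic series. -/
theorem not_bddAbove_bergmanWeight {η : ℝ} (hη : 0 < η) (hη' : η < 1 / 2) (C : ℝ) :
    ∃ k, C < bergmanWeight η k := by
  have h : ∀ k, 1 + (1 - 2 * η) * ∑ i ∈ Finset.range k, (1 / ((i : ℝ) + 1)) ≤ bergmanWeight η k := by
    intro k
    induction k with
    | zero => simp [bergmanWeight]
    | succ k ih =>
      have hk : (0 : ℝ) ≤ k := by positivity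
      have hs : 0 ≤ ∑ i ∈ Finset.range k, (1 / ((i : ℝ) + 1)) :=
        Finset.sum_nonneg fun i _ => by positivity
      have h1 : 1 ≤ bergmanWeight η k := le_trans (by nlinarith) ih
      have h2 : 1 + (1 - 2 * η) * (1 / ((k : ℝ) + 1)) ≤ (k + 1) / (2 * η + k) := by
        rw [le_div_iff₀ (by linarith)]
        have : (1 + (1 - 2 * η) * (1 / ((k : ℝ) + 1))) * (2 * η + k)
          = (k + 1) - (1 - 2 * η) * (1 - 2 * η) / (k + 1) := by field_simp; ring
        rw [this]
        have : 0 ≤ (1 - 2 * η) * (1 - 2 * η) / ((k : ℝ) + 1) :=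
          div_nonneg (mul_self_nonneg _) (by linarith)
        linarith
      rw [bergmanWeight_succ, Finset.sum_range_succ]
      have h3 : 0 ≤ (1 - 2 * η) * (1 / ((k : ℝ) + 1)) :=
        mul_nonneg (by linarith) (by positivity)
      nlinarith [mul_le_mul_of_nonneg_left h2 (by linarith : 0 ≤ bergmanWeight η k)]
  have h2 := Real.tendsto_sum_range_one_div_nat_succ_atTop
  obtain ⟨k, hk⟩ := (h2.eventually (Filter.eventually_gt_atTop ((C - 1) / (1 - 2 * η)))).exists
  refine ⟨k, lt_of_lt_of_le ?_ (h k)⟩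
  rw [div_lt_iff₀ (by linarith)] at hk
  linarith

/-- This says that z^k ↦ C(k, j) z^(k-j), a j-th derivative up to a factor, is bounded from the
Bergman space of parameter η to that of parameter η + j. The key identity is (2η)_{2j} (2η +
2j)_{k-j} = (2η)_{k+j} = (2η)_k (2η + k)_j. -/
theorem choose_sq_mul_bergmanWeight_le {η : ℝ} (hη : 0 < η) {j k : ℕ} (hjk : j ≤ k) :
    (k.choose j : ℝ) ^ 2 * bergmanWeight (η + j) (k - j)
      ≤ poch (2 * η) (2 * j) * bergmanWeight η k := by
  have hj0 : (0 : ℝ) ≤ j := by positivity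
  have p1 := poch_pos (show 0 < 2 * η by linarith) k
  have p2 := poch_pos (show 0 < 2 * (η + j) by linarith) (k - j)
  have e1 : poch (2 * η) (2 * j) * poch (2 * (η + j)) (k - j)
      = poch (2 * η) k * poch (2 * η + k) j := by
    rw [← poch_add, show (2 * (η + j) : ℝ) = 2 * η + ((2 * j : ℕ) : ℝ) by push_cast; ring,
      ← poch_add]
    congr 1
    omega
  have h1 : (k.choose j : ℝ) ≤ poch (2 * η + k) j :=
    le_trans (show (k.choose j : ℝ) ≤ (k : ℝ) ^ j by exact_mod_cast Nat.choose_le_pow k j)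
      (pow_le_poch (by positivity) (by linarith) j)
  have h2 : (k.choose j : ℝ) * (k - j).factorial ≤ k.factorial := by
    have := Nat.choose_mul_factorial_mul_factorial hjk
    have h3 : k.choose j * (k - j).factorial ≤ k.factorial := by
      calc k.choose j * (k - j).factorial ≤ k.choose j * (k - j).factorial * j.factorial :=
            Nat.le_mul_of_pos_right _ (Nat.factorial_pos j)
        _ = k.factorial := by rw [← this]; ring
    exact_mod_cast h3
  rw [bergmanWeight, bergmanWeight, ← mul_div_assoc, ← mul_div_assoc, div_le_div_iff₀ p2 p1]
  calc (k.choose j : ℝ) ^ 2 * (k - j).factorial * poch (2 * η) k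
      = (k.choose j * (k - j).factorial) * (poch (2 * η) k * k.choose j) := by ring
    _ ≤ k.factorial * (poch (2 * η) k * poch (2 * η + k) j) := by gcongr
    _ = _ := by rw [← e1]; ring

/-- The induction step shared by `weightVector_eq_sum` and `z_pow_eq_sum`: u m j stands for the j-th
term with m raisings left. Comparing coefficients needs only Pascal's rule and (j + 1) C(k, j + 1) =
(k - j) C(k, j). -/
theorem sum_choose_smul_pascal {E : Type*} [AddCommGroup E] [Module ℂ E] (c : ℂ)
    (u : ℕ → ℕ → E) (k : ℕ) :
    ∑ j ∈ Finset.range (k + 1), (k.choose j : ℂ) •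
        ((c + 2 * j + (k - j : ℕ)) • u (k - j + 1) j + (c + j) • u (k - j) (j + 1))
      = (c + k) • ∑ j ∈ Finset.range (k + 2), ((k + 1).choose j : ℂ) • u (k + 1 - j) j := by
  have hA : ∑ j ∈ Finset.range (k + 1), (k.choose j : ℂ) •
        ((c + 2 * j + (k - j : ℕ)) • u (k - j + 1) j)
      = ∑ j ∈ Finset.range (k + 2), ((k.choose j : ℂ) * (c + k + j)) • u (k + 1 - j) j := by
    rw [Finset.sum_range_succ _ (k + 1)]
    rw [Nat.choose_succ_self]
    simp only [Nat.cast_zero, zero_mul, zero_smul, add_zero]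
    refine Finset.sum_congr rfl fun j hj => ?_
    have hjk : j ≤ k := by simpa [Nat.lt_succ_iff] using hj
    rw [smul_smul, show k - j + 1 = k + 1 - j by omega, Nat.cast_sub hjk]
    congr 2
    ring
  simp only [smul_add]
  rw [Finset.sum_add_distrib, hA, Finset.smul_sum, Finset.sum_range_succ' _ (k + 1),
    Finset.sum_range_succ' _ (k + 1), add_right_comm, ← Finset.sum_add_distrib]
  congr 1
  · refine Finset.sum_congr rfl fun j hj => ?_
    have hjk : j ≤ k := by simpa [Nat.lt_succ_iff] using hj
    rw [show k + 1 - (j + 1) = k - j by omega, smul_smul, smul_smul, ← add_smul]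
    congr 1
    have h1 := Nat.choose_succ_right_eq k j
    have h2 : (k.choose (j + 1) : ℂ) * (j + 1) = k.choose j * (k - j) := by
      have := congrArg (Nat.cast : ℕ → ℂ) h1
      rw [Nat.cast_mul, Nat.cast_mul, Nat.cast_sub hjk] at this
      exact_mod_cast this
    rw [Nat.choose_succ_succ]
    push_cast
    linear_combination h2
  · simp

end HomogeneousCD

/-! ### Algebra of a covariant sl₂-triple -/

namespace HomogeneousCD

section Representation

variable {E : Type*} [NormedAddCommGroup E] [InnerProductSpace ℂ E]

theorem inner_self_eq_ofReal (x : E) : inner ℂ x x = ((‖x‖ ^ 2 : ℝ) : ℂ) := by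
  rw [inner_self_eq_norm_sq_to_K]
  norm_num

/-- The relations between `T`, minus its adjoint `z`, and an `sl₂`-triple `(D, L, B)` covariant
with them. -/
structure CovariantTriple (T z D L B : Module.End ℂ E) : Prop where
  finiteDimensional_ker : FiniteDimensional ℂ (LinearMap.ker T)
  nil : ∀ x, ∃ k : ℕ, (T ^ k) x = 0
  adj_T : FormalAdj T (-z)
  adj_D : FormalAdj D D
  adj_L : FormalAdj L B
  bracket_DT : D * T - T * D = -T
  bracket_LT : L * T - T * L = 1
  bracket_BT : B * T - T * B = T * T
  bracket_DL : D * L - L * D = L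
  bracket_DB : D * B - B * D = -B
  bracket_BL : B * L - L * B = (2 : ℂ) • D

/-- `v` is a lowest weight vector of weight `η`. -/
def IsLowest (D B : Module.End ℂ E) (η : ℝ) (v : E) : Prop :=
  B v = 0 ∧ D v = (η : ℂ) • v

namespace CovariantTriple

variable {T z D L B : Module.End ℂ E} (h : CovariantTriple T z D L B)
include h

/-- This and the next two relations are adjoints of the brackets with T. With z = -T* they are those
of multiplication by the coordinate, with L acting on powers of z as z² d/dz and B as d/dz. -/
theorem bracket_Dz : D * z - z * D = z := by
  have h1 := (h.adj_D.bracket h.adj_T).eq_of_eq h.adj_T.neg h.bracket_DT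
  linear_combination (norm := noncomm_ring) h1

theorem bracket_Bz : B * z - z * B = 1 := by
  have h1 := (h.adj_L.bracket h.adj_T).eq_of_eq FormalAdj.one h.bracket_LT
  linear_combination (norm := noncomm_ring) h1

theorem bracket_Lz : L * z - z * L = z * z := by
  have h1 := (h.adj_L.symm.bracket h.adj_T).eq_of_eq (h.adj_T.mul h.adj_T) h.bracket_BT
  linear_combination (norm := noncomm_ring) h1

theorem bracket_L_pow (k : ℕ) : L * T ^ (k + 1) - T ^ (k + 1) * L = ((k + 1 : ℕ) : ℂ) • T ^ k := by
  induction k with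
  | zero => simpa using h.bracket_LT
  | succ k ih =>
    have e : (((k + 1 + 1 : ℕ) : ℂ)) • T ^ (k + 1)
        = (((k + 1 : ℕ) : ℂ) • T ^ k) * T + T ^ (k + 1) := by
      rw [smul_mul_assoc, ← pow_succ, Nat.cast_succ (k + 1), add_smul, one_smul]
    rw [e, ← ih, pow_succ T (k + 1)]
    linear_combination (norm := noncomm_ring) T ^ (k + 1) * h.bracket_LT

/-- If Ly = 0 and T^m y is the last nonzero iterate, applying [L, T^(m+1)] = (m + 1) T^m to y gives
(m + 1) T^m y = 0. -/
theorem L_injective {y : E} (hy : L y = 0) : y = 0 := by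
  classical
  by_contra hne
  have hex := h.nil y
  obtain ⟨m, hm⟩ : ∃ m, Nat.find hex = m + 1 := by
    refine Nat.exists_eq_succ_of_ne_zero fun h0 => hne ?_
    have := Nat.find_spec hex
    rw [h0] at this
    simpa using this
  have h1 := Nat.find_spec hex
  rw [hm] at h1
  have h2 : (T ^ m) y ≠ 0 := Nat.find_min hex (by omega)
  have h3 := LinearMap.congr_fun (h.bracket_L_pow m) y
  simp only [LinearMap.sub_apply, Module.End.mul_apply, h1, hy, map_zero, sub_self,
    LinearMap.smul_apply] at h3
  exact h2 ((smul_eq_zero.1 h3.symm).resolve_left (by exact_mod_cast Nat.succ_ne_zero m))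

theorem D_L_pow {η : ℝ} {v : E} (hv : D v = (η : ℂ) • v) (k : ℕ) :
    D ((L ^ k) v) = ((η + k : ℝ) : ℂ) • (L ^ k) v := by
  induction k with
  | zero => simpa using hv
  | succ k ih =>
    rw [pow_succ', Module.End.mul_apply,
      map_eigenspace_of_bracket (r := 1) (by simpa using h.bracket_DL) ih]
    congr 1; push_cast; ring

theorem D_z_pow {η : ℝ} {v : E} (hv : D v = (η : ℂ) • v) (k : ℕ) :
    D ((z ^ k) v) = ((η + k : ℝ) : ℂ) • (z ^ k) v := by
  induction k with
  | zero => simpa using hv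
  | succ k ih =>
    rw [pow_succ', Module.End.mul_apply,
      map_eigenspace_of_bracket (r := 1) (by simpa using h.bracket_Dz) ih]
    congr 1; push_cast; ring

theorem B_L_pow {η : ℝ} {v : E} (hv : IsLowest D B η v) (k : ℕ) :
    B ((L ^ (k + 1)) v) = (((k + 1) * (2 * η + k) : ℝ) : ℂ) • (L ^ k) v := by
  have hBL : ∀ x, B (L x) = L (B x) + (2 : ℂ) • D x := fun x => by
    have := LinearMap.congr_fun h.bracket_BL x
    simp only [LinearMap.sub_apply, Module.End.mul_apply, LinearMap.smul_apply] at this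
    rw [sub_eq_iff_eq_add] at this
    rw [this, add_comm]
  induction k with
  | zero => simp [hBL, hv.1, hv.2, smul_smul, -Complex.coe_smul]
  | succ k ih =>
    rw [pow_succ', Module.End.mul_apply, hBL, ih, h.D_L_pow hv.2, map_smul,
      ← Module.End.mul_apply, ← pow_succ', smul_smul, ← add_smul]
    congr 1
    push_cast; ring

theorem inner_L_pow {η η' : ℝ} {u v : E} (hu : IsLowest D B η u) (hv : IsLowest D B η' v)
    (k l : ℕ) : inner ℂ ((L ^ k) u) ((L ^ l) v)
      = if k = l then ((k.factorial * poch (2 * η') k : ℝ) : ℂ) * inner ℂ u v else 0 := by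
  induction k generalizing l with
  | zero =>
    cases l with
    | zero => simp
    | succ l =>
      rw [pow_succ', Module.End.mul_apply, ← h.adj_L.symm, pow_zero, Module.End.one_apply, hu.1]
      simp
  | succ k ih =>
    rw [pow_succ', Module.End.mul_apply, h.adj_L]
    cases l with
    | zero => simp [hv.1]
    | succ l =>
      rw [h.B_L_pow hv, inner_smul_right, ih]
      by_cases hkl : k = l
      · subst hkl
        simp only [if_true]
        rw [poch_succ, Nat.factorial_succ]
        push_cast; ring
      · simp [hkl]

/-- ‖Lv‖² = 2η ‖v‖², and L is injective. -/
theorem weight_pos {η : ℝ} {v : E} (hv : IsLowest D B η v) (hv0 : v ≠ 0) : 0 < η := by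
  have h1 := h.inner_L_pow hv hv 1 1
  simp only [pow_one, if_true, Nat.factorial_one, Nat.cast_one, one_mul] at h1
  rw [inner_self_eq_ofReal, inner_self_eq_ofReal, poch_succ, poch_zero] at h1
  have h2 : ‖L v‖ ^ 2 = (1 * (2 * η + (0 : ℕ))) * ‖v‖ ^ 2 := by exact_mod_cast h1
  have h3 : 0 < ‖L v‖ := norm_pos_iff.2 fun h0 => hv0 (h.L_injective h0)
  have h4 : 0 < ‖v‖ := norm_pos_iff.2 hv0
  have h5 : 0 < ‖L v‖ ^ 2 := by positivity
  rw [h2] at h5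
  have := pos_of_mul_pos_left h5 (by positivity)
  simp at this
  exact this

/-- On v both BL and 2BzD act as multiplication by 2η, so B kills the difference. The operator Y = L
- 2zD measures how far z is from the Bergman shift on this module. -/
theorem isLowest_Y {η : ℝ} {v : E} (hv : IsLowest D B η v) :
    IsLowest D B (η + 1) ((L - (2 : ℂ) • (z * D)) v) := by
  constructor
  · have h1 := LinearMap.congr_fun h.bracket_BL v
    have h2 := LinearMap.congr_fun h.bracket_Bz v
    simp only [LinearMap.sub_apply, Module.End.mul_apply, LinearMap.smul_apply, hv.1, map_zero,
      sub_zero, Module.End.one_apply] at h1 h2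
    simp only [LinearMap.sub_apply, Module.End.mul_apply, LinearMap.smul_apply, map_sub, map_smul,
      hv.2, h1, h2, sub_self]
  · have h1 := h.D_L_pow hv.2 1
    have h2 := h.D_z_pow hv.2 1
    simp only [pow_one, Nat.cast_one] at h1 h2
    simp only [LinearMap.sub_apply, Module.End.mul_apply, LinearMap.smul_apply, map_sub, map_smul,
      hv.2, h1, h2, smul_sub]
    congr 1
    module

theorem isLowest_Y_pow {η : ℝ} {v : E} (hv : IsLowest D B η v) (j : ℕ) :
    IsLowest D B (η + j) (((L - (2 : ℂ) • (z * D)) ^ j) v) := by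
  induction j with
  | zero => simpa using hv
  | succ j ih =>
    have := h.isLowest_Y ih
    rw [pow_succ', Module.End.mul_apply, Nat.cast_succ, ← add_assoc]
    exact this

/-- From [L, z] = z², moving L past z^k costs k z^(k+1), and Lv = 2ηzv + Yv by definition of Y. -/
theorem L_z_pow {η : ℝ} {v : E} (hv : D v = (η : ℂ) • v) (k : ℕ) :
    L ((z ^ k) v) = ((2 * η + k : ℝ) : ℂ) • (z ^ (k + 1)) v
      + (z ^ k) ((L - (2 : ℂ) • (z * D)) v) := by
  have hLz : ∀ x, L (z x) = z (L x) + z (z x) := fun x => by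
    have := LinearMap.congr_fun h.bracket_Lz x
    simp only [LinearMap.sub_apply, Module.End.mul_apply] at this
    rw [sub_eq_iff_eq_add] at this
    rw [this, add_comm]
  induction k with
  | zero =>
    simp only [pow_zero, Module.End.one_apply, zero_add, pow_one, LinearMap.sub_apply,
      LinearMap.smul_apply, Module.End.mul_apply, hv, map_smul, Nat.cast_zero, add_zero]
    push_cast
    module
  | succ k ih =>
    rw [pow_succ', Module.End.mul_apply, hLz, ih, pow_succ' z (k + 1), Module.End.mul_apply,
      map_add, map_smul, pow_succ' z k, Module.End.mul_apply, Module.End.mul_apply]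
    push_cast
    module

end CovariantTriple

/-- The normalised weight vectors `L ^ k v / (2 η)_k`. -/
noncomputable def weightVector (L : Module.End ℂ E) (η : ℝ) (k : ℕ) (v : E) : E :=
  (((poch (2 * η) k)⁻¹ : ℝ) : ℂ) • (L ^ k) v

namespace CovariantTriple

variable {T z D L B : Module.End ℂ E} (h : CovariantTriple T z D L B)

theorem L_weightVector {η : ℝ} (hη : 0 < η) (v : E) (k : ℕ) :
    L (weightVector L η k v) = ((2 * η + k : ℝ) : ℂ) • weightVector L η (k + 1) v := by
  have hk : (0 : ℝ) ≤ k := by positivity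
  have h1 : poch (2 * η) k ≠ 0 := (poch_pos (by linarith) k).ne'
  have h2 : 2 * η + k ≠ 0 := by positivity
  rw [weightVector, weightVector, poch_succ, map_smul, smul_smul, ← Complex.ofReal_mul,
    ← Module.End.mul_apply, ← pow_succ']
  congr 2
  field_simp

include h

theorem inner_weightVector {η η' : ℝ} (hη' : 0 < η') {u v : E} (hu : IsLowest D B η u)
    (hv : IsLowest D B η' v) (k l : ℕ) :
    inner ℂ (weightVector L η k u) (weightVector L η' l v)
      = if k = l then (((poch (2 * η) k)⁻¹ * k.factorial : ℝ) : ℂ) * inner ℂ u v else 0 := by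
  rw [weightVector, weightVector, inner_smul_left, inner_smul_right, h.inner_L_pow hu hv,
    Complex.conj_ofReal]
  split_ifs with hkl
  · subst hkl
    have h1 : poch (2 * η') k ≠ 0 := (poch_pos (by linarith) k).ne'
    rw [← mul_assoc, ← mul_assoc, ← Complex.ofReal_mul, ← Complex.ofReal_mul]
    congr 2
    field_simp
  · simp

theorem norm_sq_weightVector {η : ℝ} (hη : 0 < η) {v : E} (hv : IsLowest D B η v) (k : ℕ) :
    ‖weightVector L η k v‖ ^ 2 = bergmanWeight η k * ‖v‖ ^ 2 := by
  have h1 := h.inner_weightVector hη hv hv k k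
  simp only [if_true] at h1
  rw [inner_self_eq_ofReal, inner_self_eq_ofReal] at h1
  have h2 : ‖weightVector L η k v‖ ^ 2 = ((poch (2 * η) k)⁻¹ * k.factorial) * ‖v‖ ^ 2 := by
    exact_mod_cast h1
  rw [h2, bergmanWeight]
  ring

/-- Apply L to the formula for k: by `L_z_pow` each term feeds the terms j and j + 1 of the formula
for k + 1, which `sum_choose_smul_pascal` recombines. -/
theorem weightVector_eq_sum {η : ℝ} (hη : 0 < η) {v : E} (k : ℕ)
    (Y : Module.End ℂ E) (hY : Y = L - (2 : ℂ) • (z * D))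
    (hYv : ∀ j : ℕ, D ((Y ^ j) v) = ((η + j : ℝ) : ℂ) • (Y ^ j) v) :
    weightVector L η k v = ∑ j ∈ Finset.range (k + 1), (k.choose j : ℂ) •
      (((poch (2 * η) j)⁻¹ : ℝ) : ℂ) • (z ^ (k - j)) ((Y ^ j) v) := by
  induction k with
  | zero => simp [weightVector]
  | succ k ih =>
    have hk : (0 : ℝ) ≤ k := by positivity
    have hne : ((2 * η + k : ℝ) : ℂ) ≠ 0 := by
      rw [Complex.ofReal_ne_zero]; positivity
    have h1 := L_weightVector (L := L) hη v k
    rw [← (smul_right_injective E hne).eq_iff]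
    rw [← h1, ih, map_sum]
    have h2 := sum_choose_smul_pascal ((2 * η : ℝ) : ℂ)
      (fun m j => (((poch (2 * η) j)⁻¹ : ℝ) : ℂ) • (z ^ m) ((Y ^ j) v)) k
    rw [← Complex.ofReal_natCast, ← Complex.ofReal_add] at h2
    rw [← h2]
    refine Finset.sum_congr rfl fun j hj => ?_
    have hj0 : (0 : ℝ) ≤ j := by positivity
    rw [map_smul, map_smul, h.L_z_pow (hYv j), ← hY, ← Module.End.mul_apply Y, ← pow_succ',
      smul_add]
    congr 2
    · rw [smul_smul, smul_smul, mul_comm]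
      congr 2
      push_cast; ring
    · rw [smul_smul, ← Complex.ofReal_natCast, ← Complex.ofReal_add, ← Complex.ofReal_mul,
        poch_succ]
      congr 2
      have h3 : poch (2 * η) j ≠ 0 := (poch_pos (by linarith) j).ne'
      have h4 : 2 * η + j ≠ 0 := by positivity
      field_simp

/-- The inverse triangular formula, from the recursion (2η + k) z^(k+1) v = L z^k v - z^k Yv. The
induction runs over all η and v because it is also applied to Yv, of weight η + 1. -/
theorem z_pow_eq_sum {η : ℝ} (hη : 0 < η) {v : E} (hv : D v = (η : ℂ) • v) (k : ℕ)
    (Y : Module.End ℂ E) (hY : Y = L - (2 : ℂ) • (z * D))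
    (hYv : ∀ j : ℕ, D ((Y ^ j) v) = ((η + j : ℝ) : ℂ) • (Y ^ j) v) :
    (z ^ k) v = ∑ j ∈ Finset.range (k + 1), (k.choose j : ℂ) •
      (((-1) ^ j * (poch (2 * η + j - 1) j)⁻¹ : ℝ) : ℂ)
        • weightVector L (η + j) (k - j) ((Y ^ j) v) := by
  induction k generalizing η v with
  | zero => simp [weightVector]
  | succ k ih =>
    have hk : (0 : ℝ) ≤ k := by positivity
    have hne : ((2 * η + k : ℝ) : ℂ) ≠ 0 := by
      rw [Complex.ofReal_ne_zero]; positivity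
    have h1 : ((2 * η + k : ℝ) : ℂ) • (z ^ (k + 1)) v = L ((z ^ k) v) - (z ^ k) (Y v) := by
      rw [h.L_z_pow hv, ← hY, add_sub_cancel_right]
    have hv' : D (Y v) = ((η + 1 : ℝ) : ℂ) • Y v := by simpa using hYv 1
    have ih' := ih (η := η + 1) (v := Y v) (by linarith) hv' (fun j => by
      have := hYv (j + 1)
      rw [pow_succ, Module.End.mul_apply] at this
      rw [this]; congr 1; push_cast; ring)
    rw [← (smul_right_injective E hne).eq_iff]
    rw [h1, ih', ih hη hv hYv, map_sum, ← Finset.sum_sub_distrib]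
    have h2 := sum_choose_smul_pascal ((2 * η : ℝ) : ℂ)
      (fun m j => (((-1) ^ j * (poch (2 * η + j - 1) j)⁻¹ : ℝ) : ℂ)
        • weightVector L (η + j) m ((Y ^ j) v)) k
    rw [← Complex.ofReal_natCast, ← Complex.ofReal_add] at h2
    rw [← h2]
    refine Finset.sum_congr rfl fun j hj => ?_
    have hj0 : (0 : ℝ) ≤ j := by positivity
    rw [map_smul, map_smul, L_weightVector (by linarith), ← smul_sub, sub_eq_add_neg]
    congr 2
    · rw [smul_smul, smul_smul, mul_comm]
      congr 2
      push_cast; ring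
    · rw [← Module.End.mul_apply (Y ^ j), ← pow_succ, ← neg_smul, smul_smul,
        ← Complex.ofReal_natCast j, ← Complex.ofReal_add,
        ← Complex.ofReal_mul, ← Complex.ofReal_neg]
      have e1 : η + 1 + j = η + ((j + 1 : ℕ) : ℝ) := by push_cast; ring
      have e2 : 2 * η + ((j + 1 : ℕ) : ℝ) - 1 = 2 * η + j := by push_cast; ring
      have e3 : 2 * (η + 1) + j - 1 = 2 * η + j + 1 := by ring
      rw [e1, e2, e3, poch_succ']
      congr 2
      have h3 : poch (2 * η + j + 1) j ≠ 0 := (poch_pos (by linarith) j).ne'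
      have h4 : 2 * η + j ≠ 0 := by positivity
      rw [pow_succ]
      field_simp

end CovariantTriple

end Representation

end HomogeneousCD

/-! ### Norm estimates on orthogonal families -/

namespace HomogeneousCD

section Bounded

variable {E : Type*} [NormedAddCommGroup E] [InnerProductSpace ℂ E]

theorem norm_sq_sum_of_orthogonal {ι : Type*} (s : Finset ι) (g : ι → E)
    (hg : ∀ i j, i ≠ j → inner ℂ (g i) (g j) = 0) :
    ‖∑ i ∈ s, g i‖ ^ 2 = ∑ i ∈ s, ‖g i‖ ^ 2 := by
  have h1 : inner ℂ (∑ i ∈ s, g i) (∑ i ∈ s, g i) = ((∑ i ∈ s, ‖g i‖ ^ 2 : ℝ) : ℂ) := by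
    rw [sum_inner, Complex.ofReal_sum]
    refine Finset.sum_congr rfl fun i hi => ?_
    rw [inner_sum, Finset.sum_eq_single i (fun j _ hj => hg i j hj.symm) (fun h => absurd hi h),
      inner_self_eq_ofReal]
  rw [inner_self_eq_ofReal] at h1
  exact_mod_cast h1

/-- Pythagoras on both sides. Vectors of g may vanish, which is what allows a triangular map to be
treated one diagonal at a time. -/
theorem norm_constr_le_of_orthogonal {ι : Type*} (b : Module.Basis ι ℂ E)
    (hb : ∀ i j, i ≠ j → inner ℂ (b i) (b j) = 0) (g : ι → E)
    (hg : ∀ i j, i ≠ j → inner ℂ (g i) (g j) = 0) {C : ℝ} (hC : 0 ≤ C)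
    (hgb : ∀ i, ‖g i‖ ≤ C * ‖b i‖) (x : E) : ‖b.constr ℂ g x‖ ≤ C * ‖x‖ := by
  have hx : x = ∑ i ∈ (b.repr x).support, b.repr x i • b i := (b.linearCombination_repr x).symm
  have horth : ∀ (w : ι → E), (∀ i j, i ≠ j → inner ℂ (w i) (w j) = 0) →
      ∀ i j, i ≠ j → inner ℂ (b.repr x i • w i) (b.repr x j • w j) = 0 := by
    intro w hw i j hij
    rw [inner_smul_left, inner_smul_right, hw i j hij, mul_zero, mul_zero]
  have h1 : ‖b.constr ℂ g x‖ ^ 2 = ∑ i ∈ (b.repr x).support, ‖b.repr x i • g i‖ ^ 2 := by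
    rw [Module.Basis.constr_apply, Finsupp.sum]
    exact norm_sq_sum_of_orthogonal _ _ (horth g hg)
  have h2 : ‖x‖ ^ 2 = ∑ i ∈ (b.repr x).support, ‖b.repr x i • b i‖ ^ 2 := by
    conv_lhs => rw [hx]
    exact norm_sq_sum_of_orthogonal _ _ (horth b hb)
  refine le_of_sq_le_sq ?_ (by positivity)
  rw [h1, mul_pow, h2, Finset.mul_sum]
  refine Finset.sum_le_sum fun i _ => ?_
  rw [← mul_pow, norm_smul, norm_smul]
  refine pow_le_pow_left₀ (by positivity) ?_ 2
  calc ‖b.repr x i‖ * ‖g i‖ ≤ ‖b.repr x i‖ * (C * ‖b i‖) := by gcongr; exact hgb i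
    _ = _ := by ring

theorem exists_bound_sum {ι : Type*} (s : Finset ι) (A : ι → Module.End ℂ E)
    (hA : ∀ i ∈ s, ∃ C : ℝ, ∀ x, ‖A i x‖ ≤ C * ‖x‖) :
    ∃ C : ℝ, ∀ x, ‖(∑ i ∈ s, A i) x‖ ≤ C * ‖x‖ := by
  classical
  induction s using Finset.induction_on with
  | empty => exact ⟨0, fun x => by simp⟩
  | insert i s hi ih =>
    obtain ⟨C, hC⟩ := ih fun j hj => hA j (Finset.mem_insert_of_mem hj)
    obtain ⟨C', hC'⟩ := hA i (Finset.mem_insert_self i s)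
    refine ⟨C' + C, fun x => ?_⟩
    rw [Finset.sum_insert hi, LinearMap.add_apply, add_mul]
    exact (norm_add_le _ _).trans (add_le_add (hC' x) (hC x))

end Bounded

/-! ### Decomposition into lowest weight modules -/

section Representation

variable {E : Type*} [NormedAddCommGroup E] [InnerProductSpace ℂ E]

namespace CovariantTriple

variable {T z D L B : Module.End ℂ E} (h : CovariantTriple T z D L B)
include h

/-- The weights of lowest weight vectors are bounded above. -/
theorem exists_lowest_bound : ∃ c : ℝ, (∀ (η : ℝ) (v : E), IsLowest D B η v → c < η → v = 0) ∧
    ∀ (t : ℝ) (x : E), D x = (t : ℂ) • x → ∀ k : ℕ, t + c < k → (T ^ k) x = 0 := by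
  have := h.finiteDimensional_ker
  obtain ⟨c, hc⟩ := exists_weight_bound h.nil h.bracket_DT
  refine ⟨c, fun t v hv ht => ?_, fun t x hx => (hc t x hx).1⟩
  have hbr : D * T - T * D = ((-1 : ℝ) : ℂ) • T := by rw [h.bracket_DT]; simp
  have hbr' : D * L - L * D = ((1 : ℝ) : ℂ) • L := by rw [h.bracket_DL]; simp
  have hfd := finiteDimensional_eigenspace h.nil h.bracket_DT t
  have hfd' := finiteDimensional_eigenspace h.nil h.bracket_DT (t - 1)
  have hT : ∀ x ∈ Module.End.eigenspace D (t : ℂ), T x ∈ Module.End.eigenspace D ((t - 1 : ℝ) : ℂ) := by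
    intro x hx
    rw [Module.End.mem_eigenspace_iff] at hx ⊢
    exact map_eigenspace_of_bracket hbr hx
  have hL : ∀ x ∈ Module.End.eigenspace D ((t - 1 : ℝ) : ℂ), L x ∈ Module.End.eigenspace D (t : ℂ) := by
    intro x hx
    rw [Module.End.mem_eigenspace_iff] at hx ⊢
    have := map_eigenspace_of_bracket hbr' hx
    rwa [sub_add_cancel] at this
  have hTinj : Function.Injective (T.restrict hT) := by
    rw [injective_iff_map_eq_zero]
    intro x hx
    apply Subtype.ext
    exact (hc t x (Module.End.mem_eigenspace_iff.1 x.2)).2 (congrArg Subtype.val hx) ht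
  have hLinj : Function.Injective (L.restrict hL) := by
    rw [injective_iff_map_eq_zero]
    intro x hx
    apply Subtype.ext
    exact h.L_injective (congrArg Subtype.val hx)
  -- For t > c, T is injective from weight t to weight t - 1 and L is injective back, so L is onto.
  -- Then v = Ly and ‖v‖² = ⟨y, Bv⟩ = 0.
  have hdim := le_antisymm (LinearMap.finrank_le_finrank_of_injective hTinj)
    (LinearMap.finrank_le_finrank_of_injective hLinj)
  have hLsurj := (LinearMap.injective_iff_surjective_of_finrank_eq_finrank hdim.symm).1 hLinj
  obtain ⟨y, hy⟩ := hLsurj ⟨v, Module.End.mem_eigenspace_iff.2 hv.2⟩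
  have hy' : L y = v := congrArg Subtype.val hy
  have := h.adj_L y v
  rw [hv.1, inner_zero_right, hy'] at this
  exact inner_self_eq_zero.1 this

/-- Weights in ker B are at most c, and a vector of weight t is killed by T^K once K > t + c. So ker
B sits inside one ker T^K with K > 2c. -/
theorem finiteDimensional_ker_B : FiniteDimensional ℂ (LinearMap.ker B) := by
  have := h.finiteDimensional_ker
  obtain ⟨c, hc, hc'⟩ := h.exists_lowest_bound
  obtain ⟨K, hK⟩ := exists_nat_gt (c + c)
  have := finiteDimensional_ker_pow (T := T) K
  refine Submodule.finiteDimensional_of_le (S₂ := LinearMap.ker (T ^ K)) fun x hx => ?_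
  obtain ⟨k, hk⟩ := h.nil x
  have hfd := finiteDimensional_ker_pow (T := T) k
  have hfd' : FiniteDimensional ℂ (LinearMap.ker B ⊓ LinearMap.ker (T ^ k) : Submodule ℂ E) :=
    Submodule.finiteDimensional_of_le inf_le_right
  have h1 := le_iSup_eigenspace_inf h.adj_D (LinearMap.ker B ⊓ LinearMap.ker (T ^ k)) ?_ ⟨hx, hk⟩
  · refine (iSup_le fun t => ?_ : _ ≤ LinearMap.ker (T ^ K)) h1
    rintro y ⟨hy, hy', -⟩
    have hyD : D y = (t : ℂ) • y := Module.End.mem_eigenspace_iff.1 hy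
    by_cases htc : c < t
    · have hy0 := hc t y ⟨hy', hyD⟩ htc
      rw [hy0]; exact Submodule.zero_mem _
    · exact hc' t y hyD K (by linarith)
  · rintro y ⟨hy, hy'⟩
    refine ⟨?_, map_mem_ker_pow_of_bracket_eq_neg h.bracket_DT hy'⟩
    have := LinearMap.congr_fun h.bracket_DB y
    have hy0 : B y = 0 := hy
    simpa [hy0] using this

/-- An orthonormal family of lowest weight vectors spanning all of them. -/
theorem exists_lowest_basis : ∃ (m : ℕ) (u : Fin m → E) (η : Fin m → ℝ), Orthonormal ℂ u ∧
    (∀ i, IsLowest D B (η i) (u i)) ∧ ∀ v, B v = 0 → v = ∑ i, inner ℂ (u i) v • u i := by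
  have hfd := h.finiteDimensional_ker_B
  have hpres : ∀ y ∈ LinearMap.ker B, D y ∈ LinearMap.ker B := by
    intro y hy
    have := LinearMap.congr_fun h.bracket_DB y
    have hy0 : B y = 0 := hy
    simpa [hy0] using this
  have hsym : (D.restrict hpres).IsSymmetric := fun x y => h.adj_D x y
  let b := hsym.eigenvectorBasis rfl
  refine ⟨_, fun i => (b i : E), fun i => hsym.eigenvalues rfl i, ?_, ?_, ?_⟩
  · exact b.orthonormal.comp_linearIsometry (LinearMap.ker B).subtypeₗᵢ
  · intro i
    exact ⟨(b i).2, congrArg Subtype.val (hsym.apply_eigenvectorBasis rfl i)⟩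
  · intro v hv
    have := congrArg Subtype.val (b.sum_repr' ⟨v, hv⟩)
    rw [Submodule.coe_sum] at this
    exact this.symm

/-- Induct upwards on weights, which are bounded below. A vector of weight t splits as an element of
L(weight t - 1) plus a vector orthogonal to it; the latter is killed by B because L and B are
adjoint. -/
theorem span_L_pow_eq_top {m : ℕ} {u : Fin m → E}
    (hu : ∀ v, B v = 0 → v = ∑ i, inner ℂ (u i) v • u i) :
    Submodule.span ℂ (Set.range fun p : ℕ × Fin m => (L ^ p.1) (u p.2)) = ⊤ := by
  have := h.finiteDimensional_ker
  obtain ⟨Sp, hSp⟩ : ∃ Sp, Sp = Submodule.span ℂ (Set.range fun p : ℕ × Fin m => (L ^ p.1) (u p.2)) :=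
    ⟨_, rfl⟩
  rw [← hSp]
  have hbr : D * B - B * D = ((-1 : ℝ) : ℂ) • B := by rw [h.bracket_DB]; simp
  have hbr' : D * L - L * D = ((1 : ℝ) : ℂ) • L := by rw [h.bracket_DL]; simp
  have hM : ∀ v, B v = 0 → v ∈ Sp := by
    intro v hv
    rw [hu v hv, hSp]
    refine Submodule.sum_mem _ fun i _ => Submodule.smul_mem _ _ (Submodule.subset_span ⟨(0, i), ?_⟩)
    simp
  have hLSp : ∀ v ∈ Sp, L v ∈ Sp := by
    have : Sp ≤ Sp.comap L := by
      conv_lhs => rw [hSp]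
      rw [Submodule.span_le]
      rintro _ ⟨p, rfl⟩
      rw [SetLike.mem_coe, Submodule.mem_comap, hSp]
      refine Submodule.subset_span ⟨(p.1 + 1, p.2), ?_⟩
      simp [pow_succ']
    exact this
  obtain ⟨c, hc⟩ := exists_weight_bound h.nil h.bracket_DT
  have key : ∀ (n : ℕ) (t : ℝ), t + c < n → ∀ x, D x = (t : ℂ) • x → x ∈ Sp := by
    intro n
    induction n with
    | zero =>
      intro t ht x hx
      have := (hc t x hx).1 0 ht
      have hx0 : x = 0 := by simpa using this
      rw [hx0]; exact Submodule.zero_mem _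
    | succ n ih =>
      intro t ht x hx
      push_cast at ht
      have hfd := finiteDimensional_eigenspace h.nil h.bracket_DT (t - 1)
      let W := (Module.End.eigenspace D ((t - 1 : ℝ) : ℂ)).map L
      obtain ⟨p, ⟨y, hy, rfl⟩, q, hq, hxpq⟩ := W.exists_add_mem_mem_orthogonal x
      have hy' : D y = ((t - 1 : ℝ) : ℂ) • y := Module.End.mem_eigenspace_iff.1 hy
      have hLy : D (L y) = (t : ℂ) • L y := by
        have := map_eigenspace_of_bracket hbr' hy'
        rwa [sub_add_cancel] at this
      have hq1 : D q = (t : ℂ) • q := by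
        have e : q = x - L y := by rw [hxpq]; abel
        rw [e, map_sub, hx, hLy, smul_sub]
      have hBq : D (B q) = ((t - 1 : ℝ) : ℂ) • B q := map_eigenspace_of_bracket hbr hq1
      have h0 : inner ℂ (L (B q)) q = 0 :=
        (Submodule.mem_orthogonal _ _).1 hq _ ⟨B q, Module.End.mem_eigenspace_iff.2 hBq, rfl⟩
      rw [h.adj_L] at h0
      rw [hxpq]
      exact Submodule.add_mem _ (hLSp _ (ih (t - 1) (by linarith) y hy'))
        (hM q (inner_self_eq_zero.1 h0))
  rw [eq_top_iff, ← iSup_eigenspace_real_eq_top h.nil h.adj_D h.bracket_DT]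
  refine iSup_le fun t x hx => ?_
  obtain ⟨n, hn⟩ := exists_nat_gt (t + c)
  exact key n t hn x (Module.End.mem_eigenspace_iff.1 hx)

/-- The normalised weight vectors form an orthogonal basis. -/
theorem exists_weightVector_basis {m : ℕ} {u : Fin m → E} {η : Fin m → ℝ} (hon : Orthonormal ℂ u)
    (hlow : ∀ i, IsLowest D B (η i) (u i))
    (hu : ∀ v, B v = 0 → v = ∑ i, inner ℂ (u i) v • u i) :
    ∃ b : Module.Basis (ℕ × Fin m) ℂ E, (∀ p, b p = weightVector L (η p.2) p.1 (u p.2)) ∧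
      ∀ p q, p ≠ q → inner ℂ (b p) (b q) = 0 := by
  have hη : ∀ i, 0 < η i := fun i => h.weight_pos (hlow i) (hon.ne_zero i)
  have horth : ∀ p q : ℕ × Fin m, p ≠ q → inner ℂ (weightVector L (η p.2) p.1 (u p.2))
      (weightVector L (η q.2) q.1 (u q.2)) = 0 := by
    intro p q hpq
    rw [h.inner_weightVector (hη _) (hlow _) (hlow _)]
    split_ifs with h1
    · have h2 : p.2 ≠ q.2 := fun h2 => hpq (Prod.ext h1 h2)
      rw [hon.inner_eq_zero h2, mul_zero]
    · rfl
  have hne : ∀ p : ℕ × Fin m, weightVector L (η p.2) p.1 (u p.2) ≠ 0 := by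
    intro p h0
    have h1 := h.norm_sq_weightVector (hη p.2) (hlow p.2) p.1
    rw [h0, hon.1 p.2] at h1
    have := bergmanWeight_pos (hη p.2) p.1
    simp at h1
    linarith
  have hli : LinearIndependent ℂ fun p : ℕ × Fin m => weightVector L (η p.2) p.1 (u p.2) :=
    linearIndependent_of_ne_zero_of_inner_eq_zero hne fun p q hpq => horth p q hpq
  have hsp : ⊤ ≤ Submodule.span ℂ
      (Set.range fun p : ℕ × Fin m => weightVector L (η p.2) p.1 (u p.2)) := by
    rw [← h.span_L_pow_eq_top hu, Submodule.span_le]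
    rintro _ ⟨p, rfl⟩
    have h1 : (((poch (2 * η p.2) p.1)⁻¹ : ℝ) : ℂ) ≠ 0 := by
      rw [Complex.ofReal_ne_zero]
      exact inv_ne_zero (poch_pos (by have := hη p.2; linarith) _).ne'
    have h2 : (L ^ p.1) (u p.2) = ((((poch (2 * η p.2) p.1)⁻¹ : ℝ) : ℂ))⁻¹ •
        weightVector L (η p.2) p.1 (u p.2) := by
      rw [weightVector, smul_smul, inv_mul_cancel₀ h1, one_smul]
    simp only [SetLike.mem_coe]
    rw [h2]
    exact Submodule.smul_mem _ _ (Submodule.subset_span ⟨p, rfl⟩)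
  refine ⟨Module.Basis.mk hli hsp, fun p => by rw [Module.Basis.mk_apply], fun p q hpq => ?_⟩
  rw [Module.Basis.mk_apply, Module.Basis.mk_apply]
  exact horth p q hpq

end CovariantTriple

end Representation

end HomogeneousCD

/-! ### Similarity to Bergman shifts, and growth of orbits -/

namespace HomogeneousCD

section Representation

variable {E : Type*} [NormedAddCommGroup E] [InnerProductSpace ℂ E]

theorem weightVector_sum {ι : Type*} (s : Finset ι) (L : Module.End ℂ E) (η : ℝ) (k : ℕ)
    (a : ι → ℂ) (w : ι → E) :
    weightVector L η k (∑ i ∈ s, a i • w i) = ∑ i ∈ s, a i • weightVector L η k (w i) := by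
  simp only [weightVector, map_sum, Finset.smul_sum, map_smul]
  exact Finset.sum_congr rfl fun i _ => smul_comm _ _ _

namespace CovariantTriple

variable {T z D L B : Module.End ℂ E} (h : CovariantTriple T z D L B)
include h

/-- Lower triangular transforms of the basis of normalised weight vectors are bounded. -/
theorem exists_bound_triangular {m : ℕ} {u : Fin m → E} {η : Fin m → ℝ} (hon : Orthonormal ℂ u)
    (hlow : ∀ i, IsLowest D B (η i) (u i)) (b : Module.Basis (ℕ × Fin m) ℂ E)
    (hb : ∀ p, b p = weightVector L (η p.2) p.1 (u p.2))
    (horth : ∀ p q, p ≠ q → inner ℂ (b p) (b q) = 0)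
    (Y : Module.End ℂ E) (hY : Y = L - (2 : ℂ) • (z * D)) (a : ℕ → Fin m → ℂ) :
    ∃ C : ℝ, ∀ x, ‖b.constr ℂ (fun p => ∑ j ∈ Finset.range (p.1 + 1), (p.1.choose j : ℂ) •
      a j p.2 • weightVector L (η p.2 + j) (p.1 - j) ((Y ^ j) (u p.2))) x‖ ≤ C * ‖x‖ := by
  have hη : ∀ i, 0 < η i := fun i => h.weight_pos (hlow i) (hon.ne_zero i)
  have hYlow : ∀ (j : ℕ) (i : Fin m), IsLowest D B (η i + j) ((Y ^ j) (u i)) := fun j i => by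
    rw [hY]; exact h.isLowest_Y_pow (hlow i) j
  obtain ⟨c, hc, -⟩ := h.exists_lowest_bound
  -- Y^j u_i is a lowest weight vector of weight η_i + j > c for j ≥ J, hence zero: only finitely
  -- many diagonals occur.
  obtain ⟨J, hJ⟩ := exists_nat_gt c
  have hJ0 : ∀ j i, J ≤ j → (Y ^ j) (u i) = 0 := fun j i hj => by
    refine hc _ _ (hYlow j i) ?_
    have h1 : (J : ℝ) ≤ j := by exact_mod_cast hj
    have := hη i
    linarith
  -- The piece of the transform on one diagonal j and one module i. It sends the basis to an
  -- orthogonal family, so `norm_constr_le_of_orthogonal` bounds it.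
  let g : Fin m × ℕ → ℕ × Fin m → E := fun q p => if p.2 = q.1 then
    (p.1.choose q.2 : ℂ) • a q.2 p.2 • weightVector L (η p.2 + q.2) (p.1 - q.2) ((Y ^ q.2) (u p.2))
    else 0
  have hsum : (fun p : ℕ × Fin m => ∑ j ∈ Finset.range (p.1 + 1), (p.1.choose j : ℂ) •
      a j p.2 • weightVector L (η p.2 + j) (p.1 - j) ((Y ^ j) (u p.2)))
      = ∑ q ∈ Finset.univ ×ˢ Finset.range J, g q := by
    ext p
    rw [Finset.sum_apply, Finset.sum_product, Finset.sum_eq_single p.2]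
    · simp only [g, if_true]
      rw [Finset.sum_subset (Finset.range_mono (le_max_left (p.1 + 1) J)),
        ← Finset.sum_subset (Finset.range_mono (le_max_right (p.1 + 1) J))]
      · intro j _ hj
        rw [hJ0 j p.2 (by simpa using hj)]
        simp [weightVector]
      · intro j _ hj
        rw [Nat.choose_eq_zero_of_lt (by simpa using hj)]
        simp
    · intro i _ hi
      exact Finset.sum_eq_zero fun j _ => if_neg (Ne.symm hi)
    · intro hi
      exact absurd (Finset.mem_univ _) hi
  rw [hsum, map_sum]
  refine exists_bound_sum _ _ fun q _ => ?_
  obtain ⟨i, j⟩ := q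
  have hpoch := poch_pos (show 0 < 2 * η i by have := hη i; linarith) (2 * j)
  refine ⟨‖a j i‖ * (√(poch (2 * η i) (2 * j)) * ‖(Y ^ j) (u i)‖),
    norm_constr_le_of_orthogonal b horth _ ?_ (by positivity) ?_⟩
  · intro p p' hpp
    simp only [g]
    split_ifs with h1 h2
    · by_cases hj : j ≤ p.1
      · by_cases hj' : j ≤ p'.1
        · have hi1 := hη p.2
          have hi2 := hη p'.2
          rw [inner_smul_left, inner_smul_left, inner_smul_right, inner_smul_right,
            h.inner_weightVector (by positivity) (hYlow _ _) (hYlow _ _), if_neg]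
          · simp
          · intro h3
            exact hpp (Prod.ext (by omega) (h1.trans h2.symm))
        · rw [Nat.choose_eq_zero_of_lt (not_le.1 hj')]; simp
      · rw [Nat.choose_eq_zero_of_lt (not_le.1 hj)]; simp
    all_goals simp
  · rintro ⟨k, i'⟩
    simp only [g]
    split_ifs with h1
    · obtain rfl := h1
      have hi := hη i'
      by_cases hj : j ≤ k
      · rw [norm_smul, norm_smul, Complex.norm_natCast]
        have e1 : (k.choose j : ℝ) * ‖weightVector L (η i' + j) (k - j) ((Y ^ j) (u i'))‖
            ≤ √(poch (2 * η i') (2 * j)) * ‖(Y ^ j) (u i')‖ * ‖b (k, i')‖ := by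
          refine le_of_sq_le_sq ?_ (by positivity)
          rw [mul_pow, mul_pow, mul_pow, Real.sq_sqrt hpoch.le, hb,
            h.norm_sq_weightVector (by positivity) (hYlow _ _),
            h.norm_sq_weightVector hi (hlow _), hon.1]
          have := choose_sq_mul_bergmanWeight_le hi hj
          calc (k.choose j : ℝ) ^ 2 * (bergmanWeight (η i' + j) (k - j) * ‖(Y ^ j) (u i')‖ ^ 2)
              = ((k.choose j : ℝ) ^ 2 * bergmanWeight (η i' + j) (k - j))
                * ‖(Y ^ j) (u i')‖ ^ 2 := by ring
            _ ≤ (poch (2 * η i') (2 * j) * bergmanWeight (η i') k) * ‖(Y ^ j) (u i')‖ ^ 2 := by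
              gcongr
            _ = _ := by ring
        calc (k.choose j : ℝ) * (‖a j i'‖ * ‖weightVector L (η i' + j) (k - j) ((Y ^ j) (u i'))‖)
            = ‖a j i'‖ * ((k.choose j : ℝ) *
              ‖weightVector L (η i' + j) (k - j) ((Y ^ j) (u i'))‖) := by ring
          _ ≤ ‖a j i'‖ * (√(poch (2 * η i') (2 * j)) * ‖(Y ^ j) (u i')‖ * ‖b (k, i')‖) := by
            gcongr
          _ = _ := by ring
      · rw [Nat.choose_eq_zero_of_lt (not_le.1 hj)]
        simp only [Nat.cast_zero, zero_smul, norm_zero]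
        positivity
    · rw [norm_zero]; positivity

/-- If no weight of a lowest weight vector is below `1 / 2`, then `z` is similar to a
contraction, by operators bounded for the given norm. -/
theorem exists_similarity (hhalf : ∀ η v, IsLowest D B η v → v ≠ 0 → 1 / 2 ≤ η) :
    ∃ (Γ Ψ : Module.End ℂ E) (C C' : ℝ), Γ * Ψ = 1 ∧ Ψ * Γ = 1 ∧ (∀ x, ‖Γ x‖ ≤ C * ‖x‖) ∧
      (∀ x, ‖Ψ x‖ ≤ C' * ‖x‖) ∧ ∀ x, ‖Ψ (z (Γ x))‖ ≤ 1 * ‖x‖ := by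
  obtain ⟨m, u, η, hon, hlow, hu⟩ := h.exists_lowest_basis
  obtain ⟨b, hb, horth⟩ := h.exists_weightVector_basis hon hlow hu
  have hη : ∀ i, 0 < η i := fun i => h.weight_pos (hlow i) (hon.ne_zero i)
  obtain ⟨Y, hY⟩ : ∃ Y, Y = L - (2 : ℂ) • (z * D) := ⟨_, rfl⟩
  have hYlow : ∀ {η : ℝ} {v : E}, IsLowest D B η v → ∀ j : ℕ, IsLowest D B (η + j) ((Y ^ j) v) :=
    fun hv j => by rw [hY]; exact h.isLowest_Y_pow hv j
  have hcoef : ∀ {ξ : ℝ} {v : E}, IsLowest D B ξ v → ∀ i, η i ≠ ξ → inner ℂ (u i) v = 0 :=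
    fun hv i hi => inner_eq_zero_of_eigenspace_ne h.adj_D hi (hlow i).2 hv.2
  -- expansion of normalised weight vectors in the basis
  have hexp : ∀ {ξ : ℝ} {v : E}, IsLowest D B ξ v → ∀ k : ℕ,
      weightVector L ξ k v = ∑ i, inner ℂ (u i) v • b (k, i) := by
    intro ξ v hv k
    conv_lhs => rw [hu v hv.1]
    rw [weightVector_sum]
    refine Finset.sum_congr rfl fun i _ => ?_
    by_cases hi : η i = ξ
    · rw [hb, hi]
    · rw [hcoef hv i hi, zero_smul, zero_smul]
  -- Γ sends normalised weight vectors to z-orbits. Ψ, its inverse, has the coefficients of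
  -- `weightVector_eq_sum` with each z^(k-j) Y^j v replaced by the corresponding weight vector.
  let Γ : Module.End ℂ E := b.constr ℂ fun p => (z ^ p.1) (u p.2)
  let Ψ : Module.End ℂ E := b.constr ℂ fun p => ∑ j ∈ Finset.range (p.1 + 1),
    (p.1.choose j : ℂ) • (((poch (2 * η p.2) j)⁻¹ : ℝ) : ℂ) •
      weightVector L (η p.2 + j) (p.1 - j) ((Y ^ j) (u p.2))
  have hΓb : ∀ p, Γ (b p) = (z ^ p.1) (u p.2) := fun p => b.constr_basis ℂ _ p
  have hΨb : ∀ p, Ψ (b p) = ∑ j ∈ Finset.range (p.1 + 1),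
    (p.1.choose j : ℂ) • (((poch (2 * η p.2) j)⁻¹ : ℝ) : ℂ) •
      weightVector L (η p.2 + j) (p.1 - j) ((Y ^ j) (u p.2)) := fun p => b.constr_basis ℂ _ p
  have hΓ : ∀ {ξ : ℝ} {v : E}, IsLowest D B ξ v → ∀ k : ℕ, Γ (weightVector L ξ k v) = (z ^ k) v := by
    intro ξ v hv k
    rw [hexp hv, map_sum]
    conv_rhs => rw [hu v hv.1, map_sum]
    refine Finset.sum_congr rfl fun i _ => ?_
    rw [map_smul, map_smul, hΓb]
  have hΨ : ∀ {ξ : ℝ} {v : E}, IsLowest D B ξ v → ∀ k : ℕ, Ψ (weightVector L ξ k v)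
      = ∑ j ∈ Finset.range (k + 1), (k.choose j : ℂ) • (((poch (2 * ξ) j)⁻¹ : ℝ) : ℂ) •
        weightVector L (ξ + j) (k - j) ((Y ^ j) v) := by
    intro ξ v hv k
    have e1 : ∀ j : ℕ, weightVector L (ξ + j) (k - j) ((Y ^ j) v)
        = ∑ i, inner ℂ (u i) v • weightVector L (ξ + j) (k - j) ((Y ^ j) (u i)) := by
      intro j
      conv_lhs => rw [hu v hv.1, map_sum]
      simp only [map_smul]
      rw [weightVector_sum]
    simp only [e1, Finset.smul_sum]
    rw [Finset.sum_comm, hexp hv, map_sum]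
    refine Finset.sum_congr rfl fun i _ => ?_
    by_cases hi : η i = ξ
    · rw [map_smul, hΨb, Finset.smul_sum]
      refine Finset.sum_congr rfl fun j _ => ?_
      simp only [hi]
      rw [smul_comm (inner ℂ (u i) v), smul_comm (inner ℂ (u i) v)]
    · simp [hcoef hv i hi]
  -- Apply Ψ to the expansion of the k-th weight vector in terms z^(k-j) Y^j v and compare with its
  -- defining sum. The terms with j ≥ 1 agree by induction, so those with j = 0 agree as well.
  have hΨz : ∀ k : ℕ, ∀ {ξ : ℝ} {v : E}, 0 < ξ → IsLowest D B ξ v →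
      Ψ ((z ^ k) v) = weightVector L ξ k v := by
    intro k
    induction k using Nat.strong_induction_on with
    | _ k ih =>
      intro ξ v hξ hv
      have h1 := congrArg Ψ (h.weightVector_eq_sum hξ k Y hY fun j => (hYlow hv j).2)
      rw [hΨ hv, map_sum, Finset.sum_range_succ', Finset.sum_range_succ'] at h1
      have h2 : ∀ j ∈ Finset.range k,
          Ψ ((k.choose (j + 1) : ℂ) • (((poch (2 * ξ) (j + 1))⁻¹ : ℝ) : ℂ) •
            (z ^ (k - (j + 1))) ((Y ^ (j + 1)) v))
          = (k.choose (j + 1) : ℂ) • (((poch (2 * ξ) (j + 1))⁻¹ : ℝ) : ℂ) •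
            weightVector L (ξ + (j + 1 : ℕ)) (k - (j + 1)) ((Y ^ (j + 1)) v) := by
        intro j hj
        have hj' := Finset.mem_range.1 hj
        rw [map_smul, map_smul, ih (k - (j + 1)) (by omega) (by positivity) (hYlow hv (j + 1))]
      rw [Finset.sum_congr rfl h2] at h1
      simpa using (add_left_cancel h1).symm
  refine ⟨Γ, Ψ, ?_⟩
  have hΓΨ : Γ * Ψ = 1 := by
    refine b.ext fun p => ?_
    have hi := hη p.2
    rw [Module.End.mul_apply, hΨb, map_sum, Module.End.one_apply]
    conv_rhs => rw [hb, h.weightVector_eq_sum hi p.1 Y hY fun j => (hYlow (hlow p.2) j).2]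
    refine Finset.sum_congr rfl fun j _ => ?_
    rw [map_smul, map_smul, hΓ (hYlow (hlow p.2) j)]
  have hΨΓ : Ψ * Γ = 1 := by
    refine b.ext fun p => ?_
    rw [Module.End.mul_apply, hΓb, hΨz p.1 (hη p.2) (hlow p.2), hb, Module.End.one_apply]
  obtain ⟨C, hC⟩ := h.exists_bound_triangular hon hlow b hb horth Y hY
    (fun j i => (((-1) ^ j * (poch (2 * η i + j - 1) j)⁻¹ : ℝ) : ℂ))
  obtain ⟨C', hC'⟩ := h.exists_bound_triangular hon hlow b hb horth Y hY
    (fun j i => (((poch (2 * η i) j)⁻¹ : ℝ) : ℂ))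
  refine ⟨C, C', hΓΨ, hΨΓ, ?_, hC', ?_⟩
  · intro x
    refine le_of_eq_of_le ?_ (hC x)
    refine congrArg (fun A : Module.End ℂ E => ‖A x‖) (congrArg (b.constr ℂ) (funext fun p => ?_))
    exact h.z_pow_eq_sum (hη p.2) (hlow p.2).2 p.1 Y hY fun j => (hYlow (hlow p.2) j).2
  -- After conjugation z is the forward shift on weight vectors; it is contractive because Bergman
  -- weights decrease for η ≥ 1/2.
  · have hshift : Ψ * z * Γ = b.constr ℂ fun p => b (p.1 + 1, p.2) := by
      refine b.ext fun p => ?_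
      rw [Module.Basis.constr_basis, Module.End.mul_apply, hΓb, Module.End.mul_apply,
        ← Module.End.mul_apply z, ← pow_succ', hΨz _ (hη p.2) (hlow p.2), hb]
    intro x
    have : Ψ (z (Γ x)) = (Ψ * z * Γ) x := rfl
    rw [this, hshift]
    refine norm_constr_le_of_orthogonal b horth _ ?_ zero_le_one ?_ x
    · intro p q hpq
      refine horth _ _ fun h1 => hpq ?_
      rw [Prod.mk.injEq] at h1
      exact Prod.ext (by omega) h1.2
    · intro p
      rw [one_mul]
      refine le_of_sq_le_sq ?_ (norm_nonneg _)
      rw [hb, hb, h.norm_sq_weightVector (hη _) (hlow _), h.norm_sq_weightVector (hη _) (hlow _)]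
      have := bergmanWeight_succ_le (hhalf _ _ (hlow p.2) (hon.ne_zero _)) p.1
      gcongr

/-- The orbit of a lowest weight vector under `z` dominates its normalised weight vectors. -/
theorem norm_weightVector_le {η : ℝ} (hη : 0 < η) {v : E} (hv : IsLowest D B η v) (k : ℕ) :
    ‖weightVector L η k v‖ ≤ ‖(z ^ k) v‖ := by
  obtain ⟨Y, hY⟩ : ∃ Y, Y = L - (2 : ℂ) • (z * D) := ⟨_, rfl⟩
  have hYlow : ∀ j : ℕ, IsLowest D B (η + j) ((Y ^ j) v) :=
    fun j => by rw [hY]; exact h.isLowest_Y_pow hv j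
  -- In the expansion of z^k v, the terms with j ≥ 1 involve L^(k-j), hence are orthogonal to the
  -- k-th weight vector; the j = 0 term is that vector itself.
  have h1 : inner ℂ (weightVector L η k v) ((z ^ k) v)
      = inner ℂ (weightVector L η k v) (weightVector L η k v) := by
    conv_lhs => rw [h.z_pow_eq_sum hη hv.2 k Y hY fun j => (hYlow j).2]
    rw [Finset.sum_range_succ', inner_add_right, inner_sum, Finset.sum_eq_zero]
    · simp
    · intro j hj
      have hj' := Finset.mem_range.1 hj
      rw [inner_smul_right, inner_smul_right,
        h.inner_weightVector (by positivity) hv (hYlow (j + 1)), if_neg (by omega)]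
      simp
  have h2 := norm_inner_le_norm (𝕜 := ℂ) (weightVector L η k v) ((z ^ k) v)
  rw [h1, inner_self_eq_ofReal, Complex.norm_real, norm_pow, norm_norm, sq] at h2
  rcases (norm_nonneg (weightVector L η k v)).eq_or_lt with h0 | h0
  · rw [← h0]; exact norm_nonneg _
  · exact le_of_mul_le_mul_left h2 h0

theorem exists_lt_norm_z_pow {η : ℝ} (hη : η < 1 / 2) {v : E} (hv : IsLowest D B η v)
    (hv0 : v ≠ 0) (C : ℝ) : ∃ k : ℕ, C < ‖(z ^ k) v‖ := by
  have hpos := h.weight_pos hv hv0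
  have hvn : 0 < ‖v‖ := norm_pos_iff.2 hv0
  obtain ⟨k, hk⟩ := not_bddAbove_bergmanWeight hpos hη (C ^ 2 / ‖v‖ ^ 2)
  refine ⟨k, lt_of_lt_of_le ?_ (h.norm_weightVector_le hpos hv k)⟩
  refine lt_of_pow_lt_pow_left₀ 2 (norm_nonneg _) ?_
  rw [h.norm_sq_weightVector hpos hv]
  rwa [div_lt_iff₀ (by positivity)] at hk

end CovariantTriple

end Representation

end HomogeneousCD

/-! ### Cowen–Douglas operators: surjectivity and density of the generalised kernel -/

namespace HomogeneousCD

section CowenDouglas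

variable {H : Type*} [NormedAddCommGroup H] [InnerProductSpace ℂ H]

theorem exists_sub_eq_of_norm_lt_one {F : Type*} [NormedAddCommGroup F] [NormedSpace ℂ F]
    [CompleteSpace F] {K : F →L[ℂ] F} (hK : ‖K‖ < 1) (p : F) : ∃ q, q - K q = p :=
  ⟨Ring.inverse (1 - K) p, DFunLike.congr_fun
    (Ring.mul_inverse_cancel (1 - K) (isUnit_one_sub_of_norm_lt_one hK)) p⟩

/-- A closed subspace invariant under a strict contraction `K` is mapped onto itself by
`1 - K`. -/
theorem exists_sub_eq_of_invariant {F : Type*} [NormedAddCommGroup F] [NormedSpace ℂ F]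
    [CompleteSpace F] {K : F →L[ℂ] F} (hK : ‖K‖ < 1) {Γ : Submodule ℂ F}
    (hΓ : IsClosed (Γ : Set F)) (hinv : ∀ p ∈ Γ, K p ∈ Γ) {p : F} (hp : p ∈ Γ) :
    ∃ q ∈ Γ, q - K q = p := by
  have : CompleteSpace Γ := hΓ.completeSpace_coe
  have hK₀ : ‖K.restrict hinv‖ < 1 :=
    lt_of_le_of_lt (ContinuousLinearMap.opNorm_le_bound _ (norm_nonneg K) fun x => K.le_opNorm x) hK
  obtain ⟨q, hq⟩ := exists_sub_eq_of_norm_lt_one hK₀ ⟨p, hp⟩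
  exact ⟨q, q.2, congrArg Subtype.val hq⟩

theorem exists_rightInverse [CompleteSpace H] {A : H →L[ℂ] H} (hA : Function.Surjective A) :
    ∃ R : H →L[ℂ] H, (∀ x, A (R x) = x) ∧ ∀ x y, A y = 0 → inner ℂ y (R x) = 0 := by
  let K : Submodule ℂ H := LinearMap.ker (A : H →ₗ[ℂ] H)
  have hKc : IsClosed (K : Set H) := A.isClosed_ker
  have : CompleteSpace K := hKc.completeSpace_coe
  let A₀ : Kᗮ →L[ℂ] H := A.comp Kᗮ.subtypeL
  have hker : (A₀ : Kᗮ →ₗ[ℂ] H).ker = ⊥ := by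
    rw [LinearMap.ker_eq_bot']
    intro x hx
    apply Subtype.ext
    exact inner_self_eq_zero.1 ((Submodule.mem_orthogonal _ _).1 x.2 x hx)
  have hrange : (A₀ : Kᗮ →ₗ[ℂ] H).range = ⊤ := by
    rw [LinearMap.range_eq_top]
    intro y
    obtain ⟨x, rfl⟩ := hA y
    obtain ⟨p, hp, q, hq, rfl⟩ := K.exists_add_mem_mem_orthogonal x
    refine ⟨⟨q, hq⟩, ?_⟩
    have hp' : A p = 0 := hp
    change A q = A (p + q)
    rw [map_add, hp', zero_add]
  let e := ContinuousLinearEquiv.ofBijective A₀ hker hrange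
  refine ⟨Kᗮ.subtypeL.comp (e.symm : H →L[ℂ] Kᗮ), fun x => ?_, fun x y hy => ?_⟩
  · exact e.apply_symm_apply x
  · exact (Submodule.mem_orthogonal _ _).1 (e.symm x).2 y hy

/-- If the kernels of `A - w` have constant finite dimension for `w` near `0`, then every element
of `ker A` is a limit of eigenvectors. -/
theorem inner_eq_zero_of_forall_eigenvector [CompleteSpace H] {A : H →L[ℂ] H}
    (hcl : IsClosed (Set.range A)) {n : ℕ} {r : ℝ} (hr : 0 < r)
    (hrank : ∀ w : ℂ, ‖w‖ < r → Module.rank ℂ (Module.End.eigenspace (A : H →ₗ[ℂ] H) w) = n)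
    {y : H} (hy : ∀ (w : ℂ) x, w ≠ 0 → A x = w • x → inner ℂ y x = 0) {f : H} (hf : A f = 0) :
    inner ℂ y f = 0 := by
  have hfd : ∀ w : ℂ, ‖w‖ < r →
      FiniteDimensional ℂ (Module.End.eigenspace (A : H →ₗ[ℂ] H) w) := fun w hw =>
    Module.rank_lt_aleph0_iff.1 (by rw [hrank w hw]; exact Cardinal.natCast_lt_aleph0)
  have hfr : ∀ w : ℂ, ‖w‖ < r →
      Module.finrank ℂ (Module.End.eigenspace (A : H →ₗ[ℂ] H) w) = n := fun w hw =>
    Module.finrank_eq_of_rank_eq (hrank w hw)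
  let F := Module.End.eigenspace (A : H →ₗ[ℂ] H) 0
  have hF : ∀ x, x ∈ F ↔ A x = 0 := fun x => by
    change x ∈ Module.End.eigenspace (A : H →ₗ[ℂ] H) 0 ↔ _
    rw [Module.End.mem_eigenspace_iff, zero_smul]; rfl
  have hFfd : FiniteDimensional ℂ F := hfd 0 (by simpa using hr)
  -- open mapping onto the closed range
  obtain ⟨C, hC0, hC⟩ : ∃ C > 0, ∀ x, ∃ x', A x' = A x ∧ ‖x'‖ ≤ C * ‖A x‖ := by
    have hcl' : IsClosed ((A : H →ₗ[ℂ] H).range : Set H) := by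
      rw [LinearMap.coe_range]; exact hcl
    have : CompleteSpace (A : H →ₗ[ℂ] H).range := hcl'.completeSpace_coe
    obtain ⟨C, hC0, hC⟩ := ContinuousLinearMap.exists_preimage_norm_le A.rangeRestrict (by
      rintro ⟨_, x, rfl⟩; exact ⟨x, rfl⟩)
    refine ⟨C, hC0, fun x => ?_⟩
    obtain ⟨x', hx', hn⟩ := hC ⟨A x, x, rfl⟩
    exact ⟨x', congrArg Subtype.val hx', hn⟩
  -- An eigenvector for w has ‖Ax‖ = |w| ‖x‖; subtracting a short preimage x' of Ax lands in F = ker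
  -- A, so x is within C |w| ‖x‖ of F.
  have hdist : ∀ (w : ℂ) x, A x = w • x → ‖x - F.starProjection x‖ ≤ C * ‖w‖ * ‖x‖ := by
    intro w x hx
    obtain ⟨x', hx', hn⟩ := hC x
    have hmem : x - x' ∈ F := (hF _).2 (by rw [map_sub, hx', sub_self])
    have h1 : F.starProjection (x - x') = x - x' := Submodule.starProjection_eq_self_iff.2 hmem
    have h2 : x - F.starProjection x = Fᗮ.starProjection x' := by
      rw [map_sub] at h1
      rw [Submodule.starProjection_orthogonal_val]
      rw [sub_eq_sub_iff_add_eq_add] at h1 ⊢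
      rw [← h1, add_comm]
    rw [h2]
    calc ‖Fᗮ.starProjection x'‖ ≤ ‖x'‖ := Submodule.norm_starProjection_apply_le _ _
      _ ≤ C * ‖A x‖ := hn
      _ = _ := by rw [hx, norm_smul]; ring
  have hsmall : ∀ w : ℂ, w ≠ 0 → ‖w‖ < r → C * ‖w‖ ≤ 1 / 2 →
      ‖inner ℂ y f‖ ≤ ‖y‖ * (C * ‖w‖ * (2 * ‖f‖)) := by
    intro w hw hwr hwC
    have := hfd w hwr
    let Q : Module.End.eigenspace (A : H →ₗ[ℂ] H) w →ₗ[ℂ] F :=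
      (F.orthogonalProjectionOnto : H →ₗ[ℂ] F) ∘ₗ Submodule.subtype _
    have hQ : ∀ x, ((Q x : F) : H) = F.starProjection x := fun x => rfl
    have heig : ∀ x : Module.End.eigenspace (A : H →ₗ[ℂ] H) w, A x = w • (x : H) := fun x =>
      Module.End.mem_eigenspace_iff.1 x.2
    -- For C |w| ≤ 1/2 the projection to F is injective on the w-eigenspace, hence onto by equality
    -- of dimensions. So f is the projection of a nearby eigenvector, which is orthogonal to y.
    have hinj : Function.Injective Q := by
      rw [injective_iff_map_eq_zero]
      intro x hx
      have h1 := hdist w x (heig x)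
      rw [← hQ, hx, ZeroMemClass.coe_zero, sub_zero] at h1
      have h2 : ‖(x : H)‖ ≤ 0 := by nlinarith [norm_nonneg (x : H)]
      exact Subtype.ext (norm_le_zero_iff.1 h2)
    have hsurj := (LinearMap.injective_iff_surjective_of_finrank_eq_finrank
      ((hfr w hwr).trans (hfr 0 (by simpa using hr)).symm)).1 hinj
    obtain ⟨x, hx⟩ := hsurj ⟨f, (hF f).2 hf⟩
    have hxf : F.starProjection (x : H) = f := by rw [← hQ, hx]
    have h1 := hdist w x (heig x)
    rw [hxf] at h1
    have h2 : ‖(x : H)‖ ≤ 2 * ‖f‖ := by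
      have h3 := norm_sub_norm_le (x : H) f
      nlinarith [norm_nonneg (x : H)]
    have h4 : inner ℂ y f = - inner ℂ y ((x : H) - f) := by
      rw [inner_sub_right, hy w x hw (heig x)]; ring
    rw [h4, norm_neg]
    refine (norm_inner_le_norm _ _).trans ?_
    gcongr
    refine h1.trans ?_
    gcongr
  by_contra hne
  have hpos : 0 < ‖inner ℂ y f‖ := norm_pos_iff.2 hne
  have htend : Filter.Tendsto (fun t : ℝ => ‖y‖ * (C * t * (2 * ‖f‖))) (nhdsWithin 0 (Set.Ioi 0))
      (nhds (‖y‖ * (C * 0 * (2 * ‖f‖)))) :=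
    (Continuous.tendsto (by fun_prop) 0).mono_left nhdsWithin_le_nhds
  rw [show ‖y‖ * (C * 0 * (2 * ‖f‖)) = 0 by ring] at htend
  have hev := htend.eventually (gt_mem_nhds hpos)
  have hev2 : ∀ᶠ t : ℝ in nhdsWithin 0 (Set.Ioi 0), t < min r (1 / (2 * C)) :=
    nhdsWithin_le_nhds (gt_mem_nhds (lt_min hr (by positivity)))
  obtain ⟨t, ht1, ht2, ht0⟩ := (hev.and (hev2.and self_mem_nhdsWithin)).exists
  have ht0' : 0 < t := ht0
  have hnt : ‖(t : ℂ)‖ = t := by rw [Complex.norm_real, Real.norm_eq_abs, abs_of_pos ht0']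
  have h5 := hsmall t (by exact_mod_cast ht0'.ne') (by rw [hnt]; exact ht2.trans_le (min_le_left _ _))
    (by
      rw [hnt]
      have h6 := ht2.trans_le (min_le_right _ _)
      rw [lt_div_iff₀ (by positivity)] at h6
      linarith)
  rw [hnt] at h5
  exact absurd h5 (not_le.2 ht1)

variable {n : ℕ} {T : H →L[ℂ] H}

theorem IsCowenDouglas.rank_eigenspace' (hCD : IsCowenDouglas n (Metric.ball (0 : ℂ) 1) T)
    {w : ℂ} (hw : ‖w‖ < 1) :
    Module.rank ℂ (Module.End.eigenspace (T : H →ₗ[ℂ] H) w) = n := by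
  have := hCD.rank_eigenspace (conj w) (by simpa using hw)
  rwa [Complex.conj_conj] at this

theorem IsCowenDouglas.eq_zero_of_forall_inner
    (hCD : IsCowenDouglas n (Metric.ball (0 : ℂ) 1) T) {y : H}
    (hy : ∀ (w : ℂ) x, ‖w‖ < 1 → T x = w • x → inner ℂ y x = 0) : y = 0 := by
  have hle : (⨆ z ∈ Metric.ball (0 : ℂ) 1, Module.End.eigenspace (T : H →ₗ[ℂ] H) (conj z))
      ≤ (Submodule.span ℂ {y})ᗮ := by
    refine iSup₂_le fun w hw x hx => ?_
    rw [Submodule.mem_orthogonal_singleton_iff_inner_right]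
    exact hy (conj w) x (by simpa using hw) (Module.End.mem_eigenspace_iff.1 hx)
  have htop := (Submodule.dense_iff_topologicalClosure_eq_top).1 hCD.dense_span
  have h1 : (⊤ : Submodule ℂ H) ≤ (Submodule.span ℂ {y})ᗮ := by
    rw [← htop]
    exact Submodule.topologicalClosure_minimal _ hle (Submodule.isClosed_orthogonal _)
  have h2 := (Submodule.mem_orthogonal_singleton_iff_inner_right).1 (h1 (Submodule.mem_top (x := y)))
  exact inner_self_eq_zero.1 h2

/-- A vector y orthogonal to the range of A = T - w₀ is orthogonal to every eigenvector of A with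
nonzero eigenvalue, and to ker A by approximation. The eigenvectors are total, so y = 0; the range
is closed. -/
theorem IsCowenDouglas.surjective [CompleteSpace H] (hCD : IsCowenDouglas n (Metric.ball (0 : ℂ) 1) T)
    {w₀ : ℂ} (hw₀ : ‖w₀‖ < 1) : Function.Surjective (T - w₀ • (1 : H →L[ℂ] H)) := by
  obtain ⟨A, hA⟩ : ∃ A, A = T - w₀ • (1 : H →L[ℂ] H) := ⟨_, rfl⟩
  have hAx : ∀ x, A x = T x - w₀ • x := fun x => by rw [hA]; rfl
  rw [← hA]
  have hcl : IsClosed (Set.range A) := by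
    have := hCD.isClosed_range (conj w₀) (by simpa using hw₀)
    rwa [Complex.conj_conj, ← hA] at this
  have heig : ∀ w : ℂ, Module.End.eigenspace (A : H →ₗ[ℂ] H) w
      = Module.End.eigenspace (T : H →ₗ[ℂ] H) (w₀ + w) := by
    intro w
    ext x
    rw [Module.End.mem_eigenspace_iff, Module.End.mem_eigenspace_iff]
    change A x = w • x ↔ T x = (w₀ + w) • x
    rw [hAx, sub_eq_iff_eq_add, add_smul, add_comm]
  have hrank : ∀ w : ℂ, ‖w‖ < 1 - ‖w₀‖ →
      Module.rank ℂ (Module.End.eigenspace (A : H →ₗ[ℂ] H) w) = n := by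
    intro w hw
    rw [heig]
    refine hCD.rank_eigenspace' ((norm_add_le _ _).trans_lt ?_)
    linarith
  have hbot : ((A : H →ₗ[ℂ] H).range)ᗮ = ⊥ := by
    rw [Submodule.eq_bot_iff]
    intro y hy
    have hyA : ∀ x, inner ℂ y (A x) = 0 := fun x => by
      rw [← inner_conj_symm, (Submodule.mem_orthogonal _ _).1 hy (A x) ⟨x, rfl⟩, map_zero]
    have hyw : ∀ (w : ℂ) x, w ≠ 0 → A x = w • x → inner ℂ y x = 0 := by
      intro w x hw hx
      have := hyA x
      rw [hx, inner_smul_right, mul_eq_zero] at this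
      exact this.resolve_left hw
    refine hCD.eq_zero_of_forall_inner fun w x hw hx => ?_
    by_cases hww : w = w₀
    · subst hww
      exact inner_eq_zero_of_forall_eigenvector hcl (by linarith) hrank hyw
        (by rw [hAx, hx, sub_self])
    · exact hyw (w - w₀) x (sub_ne_zero.2 hww) (by rw [hAx, hx, sub_smul])
  have htop := Submodule.topologicalClosure_eq_top_iff.2 hbot
  have hcl' : IsClosed ((A : H →ₗ[ℂ] H).range : Set H) := by
    rw [LinearMap.coe_range]; exact hcl
  rw [hcl'.submodule_topologicalClosure_eq] at htop
  exact LinearMap.range_eq_top.1 htop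

/-- The generalised kernel of `T`. -/
def nilSpace (T : H →L[ℂ] H) : Submodule ℂ H where
  carrier := {x | ∃ k : ℕ, (T ^ k) x = 0}
  zero_mem' := ⟨0, by simp⟩
  smul_mem' := by
    rintro c x ⟨k, hk⟩
    exact ⟨k, by rw [map_smul, hk, smul_zero]⟩
  add_mem' := by
    rintro x y ⟨k, hk⟩ ⟨l, hl⟩
    refine ⟨k + l, ?_⟩
    have h1 : (T ^ (k + l)) x = 0 := by
      rw [add_comm, pow_add, mul_apply_eq_comp, hk, map_zero]
    have h2 : (T ^ (k + l)) y = 0 := by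
      rw [pow_add, mul_apply_eq_comp, hl, map_zero]
    rw [map_add, h1, h2, add_zero]

theorem map_mem_nilSpace {x : H} (hx : x ∈ nilSpace T) : T x ∈ nilSpace T := by
  obtain ⟨k, hk⟩ := hx
  refine ⟨k, ?_⟩
  rw [← mul_apply_eq_comp, ← pow_succ, pow_succ', mul_apply_eq_comp, hk,
    map_zero]

/-- Let y be orthogonal to V and R a right inverse of T - w₀. For w near w₀, ker(T - w) consists of
the vectors (1 - (w - w₀)R)⁻¹ f with f in ker(T - w₀). At w₀ = 0 these lie in the closure of V, and
the identity theorem carries orthogonality to y over the whole disc. -/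
theorem IsCowenDouglas.dense_nilSpace [CompleteSpace H] (hCD : IsCowenDouglas n (Metric.ball (0 : ℂ) 1) T) :
    (nilSpace T).topologicalClosure = ⊤ := by
  rw [Submodule.topologicalClosure_eq_top_iff, Submodule.eq_bot_iff]
  intro y hy
  have hyV : ∀ x ∈ nilSpace T, inner ℂ y x = 0 := fun x hx => by
    rw [← inner_conj_symm, (Submodule.mem_orthogonal _ _).1 hy x hx, map_zero]
  let P : ℂ → Prop := fun w => ∀ x, T x = w • x → inner ℂ y x = 0
  -- local description of eigenvectors
  have hloc : ∀ w₀ : ℂ, ‖w₀‖ < 1 → ∃ R : H →L[ℂ] H, ∃ ε > 0,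
      (∀ x, T (R x) = w₀ • R x + x) ∧ ∀ w ∈ Metric.ball w₀ ε, ‖(w - w₀) • R‖ < 1 := by
    intro w₀ hw₀
    obtain ⟨R, hR, -⟩ := exists_rightInverse (hCD.surjective hw₀)
    refine ⟨R, (‖R‖ + 1)⁻¹, by positivity, fun x => ?_, fun w hw => ?_⟩
    · have h1 : T (R x) - w₀ • R x = x := hR x
      rw [sub_eq_iff_eq_add] at h1
      rw [h1, add_comm]
    · rw [Metric.mem_ball, dist_eq_norm] at hw
      rw [norm_smul]
      have h1 : 0 < ‖R‖ + 1 := by positivity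
      calc ‖w - w₀‖ * ‖R‖ ≤ ‖w - w₀‖ * (‖R‖ + 1) := by gcongr; linarith
        _ < (‖R‖ + 1)⁻¹ * (‖R‖ + 1) := by gcongr
        _ = 1 := inv_mul_cancel₀ h1.ne'
  have hker : ∀ (w₀ w : ℂ) (R : H →L[ℂ] H), (∀ x, T (R x) = w₀ • R x + x) → ∀ x,
      T (x - (w - w₀) • R x) - w₀ • (x - (w - w₀) • R x) = T x - w • x := by
    intro w₀ w R hR x
    rw [map_sub, map_smul, hR]
    module
  have hcont : ∀ w₀ : ℂ, ‖w₀‖ < 1 → ∃ ε > 0, ∀ w₁ ∈ Metric.ball w₀ ε,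
      (∀ᶠ w in nhds w₁, P w) → ∀ w ∈ Metric.ball w₀ ε, P w := by
    intro w₀ hw₀
    obtain ⟨R, ε, hε, hR, hRn⟩ := hloc w₀ hw₀
    refine ⟨ε, hε, fun w₁ hw₁ hev w hw x hx => ?_⟩
    obtain ⟨f, hf⟩ : ∃ f, f = x - (w - w₀) • R x := ⟨_, rfl⟩
    have hTf : T f - w₀ • f = 0 := by rw [hf, hker w₀ w R hR, hx, sub_self]
    let φ : ℂ → ℂ := fun v => inner ℂ y (Ring.inverse (1 - (v - w₀) • R) f)
    have hinv : ∀ v ∈ Metric.ball w₀ ε, Ring.inverse (1 - (v - w₀) • R) f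
        - (v - w₀) • R (Ring.inverse (1 - (v - w₀) • R) f) = f := fun v hv =>
      DFunLike.congr_fun (Ring.mul_inverse_cancel _ (isUnit_one_sub_of_norm_lt_one (hRn v hv))) f
    have hdiff : DifferentiableOn ℂ φ (Metric.ball w₀ ε) := by
      intro v hv
      apply DifferentiableAt.differentiableWithinAt
      have h1 : DifferentiableAt ℂ (fun v : ℂ => Ring.inverse (1 - (v - w₀) • R)) v :=
        (differentiableAt_inverse (isUnit_one_sub_of_norm_lt_one (hRn v hv))).comp v
          (f := fun v : ℂ => 1 - (v - w₀) • R)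
          ((differentiableAt_const _).sub ((differentiableAt_id.sub_const w₀).smul_const R))
      exact (innerSL ℂ y).differentiableAt.comp v (h1.clm_apply (differentiableAt_const f))
    have hana := hdiff.analyticOnNhd Metric.isOpen_ball
    have hzero : φ =ᶠ[nhds w₁] 0 := by
      filter_upwards [hev, Metric.isOpen_ball.mem_nhds hw₁] with v hv hvb
      refine hv _ ?_
      have h1 := hker w₀ v R hR (Ring.inverse (1 - (v - w₀) • R) f)
      rw [hinv v hvb, hTf] at h1
      exact (sub_eq_zero.1 h1.symm)
    have h2 := hana.eqOn_zero_of_preconnected_of_eventuallyEq_zero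
      (convex_ball w₀ ε).isPreconnected hw₁ hzero hw
    have h3 : Ring.inverse (1 - (w - w₀) • R) f = x := by
      rw [hf]
      exact DFunLike.congr_fun
        (Ring.inverse_mul_cancel _ (isUnit_one_sub_of_norm_lt_one (hRn w hw))) x
    have h4 : inner ℂ y (Ring.inverse (1 - (w - w₀) • R) f) = 0 := h2
    rwa [h3] at h4
  have hzero : ∀ᶠ w in nhds (0 : ℂ), P w := by
    obtain ⟨R, ε, hε, hR, hRn⟩ := hloc 0 (by simp)
    filter_upwards [Metric.ball_mem_nhds 0 hε] with w hw x hx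
    have hTR : ∀ x, T (R x) = x := fun x => by rw [hR]; simp
    have hf : x - w • R x ∈ (nilSpace T).topologicalClosure := by
      refine Submodule.le_topologicalClosure _ ⟨1, ?_⟩
      rw [pow_one, map_sub, map_smul, hTR, hx, sub_self]
    have hinv : ∀ p ∈ (nilSpace T).topologicalClosure, (w • R) p ∈ (nilSpace T).topologicalClosure := by
      have h1 : nilSpace T ≤ (nilSpace T).topologicalClosure.comap (w • R : H →L[ℂ] H).toLinearMap := by
        rintro p ⟨k, hk⟩
        refine Submodule.le_topologicalClosure _ ⟨k + 1, ?_⟩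
        change (T ^ (k + 1)) (w • R p) = 0
        rw [map_smul, pow_succ, mul_apply_eq_comp, hTR, hk, smul_zero]
      exact Submodule.topologicalClosure_minimal _ h1
        ((Submodule.isClosed_topologicalClosure _).preimage (w • R).continuous)
    have hn : ‖w • R‖ < 1 := by simpa using hRn w hw
    obtain ⟨q, hq, hqe⟩ := exists_sub_eq_of_invariant hn (Submodule.isClosed_topologicalClosure _)
      hinv hf
    have hqx : q = x := by
      have h1 : (1 - w • R) (q - x) = 0 := by
        change (q - x) - (w • R) (q - x) = 0
        rw [map_sub, sub_sub_sub_comm, hqe]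
        exact sub_self _
      have h2 := DFunLike.congr_fun (Ring.inverse_mul_cancel _ (isUnit_one_sub_of_norm_lt_one hn))
        (q - x)
      rw [mul_apply_eq_comp, h1, map_zero] at h2
      exact sub_eq_zero.1 h2.symm
    rw [← hqx]
    have hle : (nilSpace T).topologicalClosure ≤ (Submodule.span ℂ {y})ᗮ :=
      Submodule.topologicalClosure_minimal _ (fun x hx => by
        rw [Submodule.mem_orthogonal_singleton_iff_inner_right]; exact hyV x hx)
        (Submodule.isClosed_orthogonal _)
    exact (Submodule.mem_orthogonal_singleton_iff_inner_right).1 (hle hq)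
  -- The set where P holds locally is open, nonempty, and by `hcont` relatively closed in the
  -- connected disc.
  have hsub : Metric.ball (0 : ℂ) 1 ⊆ {w | ∀ᶠ v in nhds w, P v} := by
    refine (convex_ball (0 : ℂ) 1).isPreconnected.subset_of_closure_inter_subset
      isOpen_setOfPred_eventually_nhds ⟨0, by simp, hzero⟩ ?_
    rintro w₀ ⟨hcl, hw₀⟩
    obtain ⟨ε, hε, hc⟩ := hcont w₀ (by simpa using hw₀)
    obtain ⟨w₁, hw₁, hev⟩ := (mem_closure_iff_nhds.1 hcl) _ (Metric.ball_mem_nhds w₀ hε)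
    filter_upwards [Metric.ball_mem_nhds w₀ hε] with w hw
    exact hc w₁ hw₁ hev w hw
  refine hCD.eq_zero_of_forall_inner fun w x hw hx => ?_
  exact (hsub (show w ∈ Metric.ball (0 : ℂ) 1 by simpa using hw)).self_of_nhds x hx

end CowenDouglas

end HomogeneousCD

/-! ### The grading produced by an irrational rotation -/

namespace HomogeneousCD

section Grading

/-- Choose representatives of the cosets of the infinite cyclic group generated by ω and let δ
record the exponent. It turns eigenvalues of the unitary into real weights, with multiplication by ω
becoming a shift by one. -/
theorem exists_additive_grading {ω : ℂ} (hω0 : ω ≠ 0) (hω : ∀ k : ℤ, ω ^ k = 1 → k = 0) :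
    ∃ δ : ℂ → ℝ, ∀ α, α ≠ 0 → δ (ω * α) = δ α + 1 := by
  let w : ℂˣ := Units.mk0 ω hω0
  have hw : ∀ k : ℤ, w ^ k = 1 → k = 0 := fun k hk => hω k (by
    have := congrArg Units.val hk
    simpa [w] using this)
  let q : ℂˣ → ℂˣ ⧸ Subgroup.zpowers w := QuotientGroup.mk
  have hq : ∀ x : ℂˣ, ∃ k : ℤ, x = (q x).out * w ^ k := fun x => by
    have h1 : q x = q (q x).out := (QuotientGroup.out_eq' (q x)).symm
    obtain ⟨k, hk⟩ := QuotientGroup.eq.1 h1.symm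
    refine ⟨k, ?_⟩
    have hk' : w ^ k = (q x).out⁻¹ * x := hk
    rw [hk', mul_inv_cancel_left]
  choose κ hκ using hq
  refine ⟨fun α => if hα : α = 0 then 0 else κ (Units.mk0 α hα), fun α hα => ?_⟩
  have hωα : ω * α ≠ 0 := mul_ne_zero hω0 hα
  simp only [hα, hωα, dif_neg, not_false_eq_true]
  let x : ℂˣ := Units.mk0 α hα
  have hx : Units.mk0 (ω * α) hωα = x * w := by
    ext; simp [x, w, mul_comm]
  rw [hx]
  have hqx : q (x * w) = q x := by
    refine QuotientGroup.eq.2 ⟨-1, ?_⟩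
    simp
  have h1 := hκ (x * w)
  rw [hqx] at h1
  nth_rewrite 1 [hκ x] at h1
  rw [mul_assoc, mul_left_cancel_iff, ← zpow_add_one] at h1
  have h2 : w ^ (κ x + 1 - κ (x * w)) = 1 := by rw [zpow_sub, h1, mul_inv_cancel]
  have h3 := hw _ h2
  have h4 : κ (x * w) = κ x + 1 := by linarith
  rw [h4]; push_cast; rfl

variable {E : Type*} [NormedAddCommGroup E] [InnerProductSpace ℂ E]

theorem isometry_eigenvalue_ne_zero {u : Module.End ℂ E}
    (hu : ∀ x y, inner ℂ (u x) (u y) = inner ℂ x y) {α : ℂ} {x : E} (hx : u x = α • x)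
    (hx0 : x ≠ 0) : conj α * α = 1 := by
  have h1 := hu x x
  rw [hx, inner_smul_left, inner_smul_right, ← mul_assoc] at h1
  exact mul_right_cancel₀ (inner_self_ne_zero.2 hx0) (h1.trans (one_mul _).symm)

/-- An isometry has no Jordan blocks: if ux = αx + y and uy = αy, comparing ⟨ux, uy⟩ with ⟨x, y⟩
forces α ‖y‖² = 0. -/
theorem iSup_eigenspace_isometry_eq_top [FiniteDimensional ℂ E] {u : Module.End ℂ E}
    (hu : ∀ x y, inner ℂ (u x) (u y) = inner ℂ x y) :
    ⨆ α : ℂ, Module.End.eigenspace u α = ⊤ := by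
  have key : ∀ (α : ℂ) (x : E), ((u - α • 1) * (u - α • 1)) x = 0 → (u - α • 1) x = 0 := by
    intro α x hx
    obtain ⟨y, hy⟩ : ∃ y, y = (u - α • (1 : Module.End ℂ E)) x := ⟨_, rfl⟩
    rw [Module.End.mul_apply, ← hy] at hx
    rw [← hy]
    have hux : u x = α • x + y := by rw [hy]; simp
    have huy : u y = α • y := by
      have h1 : u y - α • y = 0 := hx
      exact sub_eq_zero.1 h1
    by_contra hne
    have hα := isometry_eigenvalue_ne_zero hu huy hne
    have h2 := hu x y
    rw [hux, huy, inner_add_left, inner_smul_left, inner_smul_right, inner_smul_right, ← mul_assoc,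
      hα, one_mul, add_eq_left, mul_eq_zero] at h2
    rcases h2 with h2 | h2
    · rw [h2] at hα; simp at hα
    · exact hne (inner_self_eq_zero.1 h2)
  have key2 : ∀ (α : ℂ) (m : ℕ) (x : E), ((u - α • 1) ^ (m + 1)) x = 0 → (u - α • 1) x = 0 := by
    intro α m
    induction m with
    | zero => intro x hx; simpa using hx
    | succ m ih =>
      intro x hx
      refine ih x ?_
      rw [pow_succ', Module.End.mul_apply]
      refine key α _ ?_
      rw [← Module.End.mul_apply, mul_assoc, ← pow_succ', ← pow_succ']
      exact hx
  rw [eq_top_iff, ← Module.End.iSup_maxGenEigenspace_eq_top u]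
  refine iSup_mono fun α x hx => ?_
  obtain ⟨m, hm⟩ := (Module.End.mem_maxGenEigenspace u α x).1 hx
  rw [Module.End.mem_eigenspace_iff]
  have h1 : ((u - α • 1) ^ (m + 1)) x = 0 := by
    rw [pow_succ', Module.End.mul_apply, hm, map_zero]
  exact sub_eq_zero.1 (key2 α m x h1)

/-- A diagonalisable operator has a functional calculus. -/
theorem exists_diagonal {u : Module.End ℂ E} (htop : ⨆ α : ℂ, Module.End.eigenspace u α = ⊤)
    (δ : ℂ → ℂ) : ∃ D : Module.End ℂ E, ∀ α x, u x = α • x → D x = δ α • x := by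
  classical
  have hint : DirectSum.IsInternal fun α => Module.End.eigenspace u α :=
    DirectSum.isInternal_submodule_of_iSupIndep_of_iSup_eq_top
      (Module.End.eigenspaces_iSupIndep u) htop
  let e := LinearEquiv.ofBijective (DirectSum.coeLinearMap fun α => Module.End.eigenspace u α) hint
  let Δ := DirectSum.toModule ℂ ℂ E fun α => δ α • (Module.End.eigenspace u α).subtype
  refine ⟨Δ ∘ₗ e.symm.toLinearMap, fun α x hx => ?_⟩
  let x' : Module.End.eigenspace u α := ⟨x, Module.End.mem_eigenspace_iff.2 hx⟩
  have h1 : e (DirectSum.lof ℂ ℂ (fun α => Module.End.eigenspace u α) α x') = x :=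
    DirectSum.coeLinearMap_lof _ _ x'
  have h2 : e.symm x = DirectSum.lof ℂ ℂ (fun α => Module.End.eigenspace u α) α x' := by
    rw [← h1, e.symm_apply_apply]
  change Δ (e.symm x) = _
  rw [h2, DirectSum.toModule_lof]
  rfl

/-- An isometry intertwining `T` with an irrational rotation of `T` gives a grading. -/
theorem exists_grading {T u : Module.End ℂ E} [FiniteDimensional ℂ (LinearMap.ker T)]
    (hnil : ∀ x, ∃ k : ℕ, (T ^ k) x = 0) (hu : ∀ x y, inner ℂ (u x) (u y) = inner ℂ x y)
    {ω : ℂ} (hω0 : ω ≠ 0) (hω : ∀ k : ℤ, ω ^ k = 1 → k = 0) (hTu : T * u = ω • (u * T)) :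
    ∃ D : Module.End ℂ E, FormalAdj D D ∧ D * T - T * D = -T := by
  obtain ⟨δ, hδ⟩ := exists_additive_grading hω0 hω
  have hTk : ∀ k : ℕ, T ^ k * u = ω ^ k • (u * T ^ k) := by
    intro k
    induction k with
    | zero => simp
    | succ k ih =>
      rw [pow_succ T, mul_assoc, hTu, mul_smul_comm, ← mul_assoc, ih, smul_mul_assoc, mul_assoc,
        smul_smul, pow_succ' ω]
  have htop : ⨆ α : ℂ, Module.End.eigenspace u α = ⊤ := by
    rw [eq_top_iff]
    intro x _
    obtain ⟨k, hk⟩ := hnil x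
    have hfd := finiteDimensional_ker_pow (T := T) k
    have hpres : ∀ y ∈ LinearMap.ker (T ^ k), u y ∈ LinearMap.ker (T ^ k) := by
      intro y hy
      have hy' : (T ^ k) y = 0 := hy
      have := LinearMap.congr_fun (hTk k) y
      simpa [hy'] using this
    have h1 := iSup_eigenspace_isometry_eq_top (u := u.restrict hpres)
      (fun x y => hu x y)
    have h2 : (⟨x, hk⟩ : LinearMap.ker (T ^ k)) ∈ ⨆ α : ℂ, Module.End.eigenspace (u.restrict hpres) α := by
      rw [h1]; trivial
    have h3 := Submodule.mem_map_of_mem (f := (LinearMap.ker (T ^ k)).subtype) h2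
    rw [Submodule.map_iSup] at h3
    refine (iSup_mono fun α => ?_ : _ ≤ ⨆ α : ℂ, Module.End.eigenspace u α) h3
    rintro _ ⟨y, hy, rfl⟩
    rw [SetLike.mem_coe, Module.End.mem_eigenspace_iff] at hy
    exact Module.End.mem_eigenspace_iff.2 (congrArg Subtype.val hy)
  obtain ⟨D, hD⟩ := exists_diagonal htop fun α => (δ α : ℂ)
  have hmem : ∀ x : E, x ∈ ⨆ α : ℂ, Module.End.eigenspace u α := fun x => by rw [htop]; trivial
  refine ⟨D, fun x y => ?_, LinearMap.ext fun x => ?_⟩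
  · induction hmem x using Submodule.iSup_induction' with
    | zero => simp
    | add x x' _ _ h h' => rw [map_add, inner_add_left, inner_add_left, h, h']
    | mem α x hx =>
      induction hmem y using Submodule.iSup_induction' with
      | zero => simp
      | add y y' _ _ h h' => rw [map_add, inner_add_right, inner_add_right, h, h']
      | mem β y hy =>
        rw [Module.End.mem_eigenspace_iff] at hx hy
        rw [hD α x hx, hD β y hy, inner_smul_left, inner_smul_right, Complex.conj_ofReal]
        by_cases hαβ : α = β
        · rw [hαβ]
        · by_cases hx0 : x = 0
          · simp [hx0]
          have hα := isometry_eigenvalue_ne_zero hu hx hx0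
          have h1 := hu x y
          rw [hx, hy, inner_smul_left, inner_smul_right, ← mul_assoc] at h1
          have h2 : (conj α * β - 1) * inner ℂ x y = 0 := by rw [sub_mul, h1, one_mul, sub_self]
          rcases mul_eq_zero.1 h2 with h3 | h3
          · exfalso
            have h4 : conj α ≠ 0 := left_ne_zero_of_mul_eq_one hα
            exact hαβ (mul_left_cancel₀ h4 (hα.trans (sub_eq_zero.1 h3).symm))
          · rw [h3, mul_zero, mul_zero]
  · induction hmem x using Submodule.iSup_induction' with
    | zero => simp
    | add x x' _ _ h h' => rw [map_add, map_add, h, h']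
    | mem α x hx =>
      rw [Module.End.mem_eigenspace_iff] at hx
      simp only [LinearMap.sub_apply, Module.End.mul_apply, LinearMap.neg_apply]
      by_cases hx0 : x = 0
      · simp [hx0]
      have hα := right_ne_zero_of_mul_eq_one (isometry_eigenvalue_ne_zero hu hx hx0)
      have h1 := LinearMap.congr_fun hTu x
      simp only [Module.End.mul_apply, hx, map_smul, LinearMap.smul_apply] at h1
      have h2 : u (T x) = (ω⁻¹ * α) • T x := by
        rw [mul_smul, h1, smul_smul, inv_mul_cancel₀ hω0, one_smul]
      have h3 := hδ (ω⁻¹ * α) (mul_ne_zero (inv_ne_zero hω0) hα)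
      rw [mul_inv_cancel_left₀ hω0] at h3
      rw [hD _ _ h2, hD _ _ hx, map_smul, h3]
      push_cast
      module

end Grading

end HomogeneousCD

/-! ### The closure of the grading operator -/

namespace HomogeneousCD

section Closure

variable {H : Type*} [NormedAddCommGroup H] [InnerProductSpace ℂ H] {T : H →L[ℂ] H}

/-- The restriction of `T` to its generalised kernel. -/
def nilOp (T : H →L[ℂ] H) : Module.End ℂ (nilSpace T) :=
  (T : H →ₗ[ℂ] H).restrict fun _ hx => map_mem_nilSpace hx

theorem coe_nilOp (x : nilSpace T) : (nilOp T x : H) = T x := rfl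

theorem coe_nilOp_pow (k : ℕ) (x : nilSpace T) : ((nilOp T ^ k) x : H) = (T ^ k) x := by
  induction k with
  | zero => rfl
  | succ k ih =>
    rw [pow_succ', Module.End.mul_apply, coe_nilOp, ih, pow_succ', mul_apply_eq_comp]

theorem nilOp_nil (x : nilSpace T) : ∃ k : ℕ, (nilOp T ^ k) x = 0 := by
  obtain ⟨k, hk⟩ := x.2
  exact ⟨k, Subtype.ext ((coe_nilOp_pow k x).trans hk)⟩

theorem IsCowenDouglas.finiteDimensional_ker_nilOp {n : ℕ}
    (hCD : IsCowenDouglas n (Metric.ball (0 : ℂ) 1) T) :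
    FiniteDimensional ℂ (LinearMap.ker (nilOp T)) := by
  have hfd : FiniteDimensional ℂ (Module.End.eigenspace (T : H →ₗ[ℂ] H) 0) :=
    Module.rank_lt_aleph0_iff.1 (by
      rw [hCD.rank_eigenspace' (by simp)]; exact Cardinal.natCast_lt_aleph0)
  let f : LinearMap.ker (nilOp T) →ₗ[ℂ] Module.End.eigenspace (T : H →ₗ[ℂ] H) 0 :=
    LinearMap.codRestrict _ ((nilSpace T).subtype ∘ₗ (LinearMap.ker (nilOp T)).subtype) fun x => by
      rw [Module.End.mem_eigenspace_iff, zero_smul]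
      exact congrArg Subtype.val (LinearMap.mem_ker.1 x.2)
  refine FiniteDimensional.of_injective f fun x y hxy => ?_
  have h1 : ((f x : Module.End.eigenspace (T : H →ₗ[ℂ] H) 0) : H) = f y := by rw [hxy]
  exact Subtype.ext (Subtype.ext h1)

/-- The closure of the graph of an operator defined on the generalised kernel. -/
def graphClosure (D : Module.End ℂ (nilSpace T)) : Submodule ℂ (H × H) :=
  (LinearMap.range ((nilSpace T).subtype.prod ((nilSpace T).subtype ∘ₗ D))).topologicalClosure

theorem mem_graphClosure (D : Module.End ℂ (nilSpace T)) (x : nilSpace T) :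
    ((x : H), (D x : H)) ∈ graphClosure D :=
  Submodule.le_topologicalClosure _ ⟨x, rfl⟩

theorem graphClosure_le {D : Module.End ℂ (nilSpace T)} {Γ : Submodule ℂ (H × H)}
    (hΓ : IsClosed (Γ : Set (H × H))) (h : ∀ x : nilSpace T, ((x : H), (D x : H)) ∈ Γ) :
    graphClosure D ≤ Γ := by
  refine Submodule.topologicalClosure_minimal _ ?_ hΓ
  rintro _ ⟨x, rfl⟩
  exact h x

theorem map_mem_graphClosure {D : Module.End ℂ (nilSpace T)} (K : H × H →L[ℂ] H × H)
    (h : ∀ x : nilSpace T, K ((x : H), (D x : H)) ∈ graphClosure D) {p : H × H}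
    (hp : p ∈ graphClosure D) : K p ∈ graphClosure D :=
  (graphClosure_le (Γ := (graphClosure D).comap K.toLinearMap)
    ((Submodule.isClosed_topologicalClosure _).preimage K.continuous) h) hp

theorem inner_graphClosure {D : Module.End ℂ (nilSpace T)} (hD : FormalAdj D D) {p q : H × H}
    (hp : p ∈ graphClosure D) (hq : q ∈ graphClosure D) :
    inner ℂ p.2 q.1 = inner ℂ p.1 q.2 := by
  have h1 : ∀ x : nilSpace T, ∀ q ∈ graphClosure D,
      inner ℂ (D x : H) q.1 = inner ℂ (x : H) q.2 := by
    intro x q hq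
    let φ : H × H →L[ℂ] ℂ := (innerSL ℂ (D x : H)).comp (ContinuousLinearMap.fst ℂ H H)
      - (innerSL ℂ (x : H)).comp (ContinuousLinearMap.snd ℂ H H)
    have h2 : graphClosure D ≤ LinearMap.ker (φ : H × H →ₗ[ℂ] ℂ) :=
      graphClosure_le φ.isClosed_ker fun y => sub_eq_zero.2 (hD x y)
    exact sub_eq_zero.1 (h2 hq)
  let φ : H × H →L[ℂ] ℂ := (innerSL ℂ q.1).comp (ContinuousLinearMap.snd ℂ H H)
      - (innerSL ℂ q.2).comp (ContinuousLinearMap.fst ℂ H H)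
  have h2 : graphClosure D ≤ LinearMap.ker (φ : H × H →ₗ[ℂ] ℂ) :=
    graphClosure_le φ.isClosed_ker fun y => sub_eq_zero.2 (by
      change inner ℂ q.1 (D y : H) = inner ℂ q.2 (y : H)
      rw [← inner_conj_symm, h1 y q hq, inner_conj_symm])
  have h3 : inner ℂ q.1 p.2 = inner ℂ q.2 p.1 := sub_eq_zero.1 (h2 hp)
  rw [← inner_conj_symm, h3, inner_conj_symm]

theorem T_mem_graphClosure {D : Module.End ℂ (nilSpace T)}
    (hDT : D * nilOp T - nilOp T * D = -nilOp T) {x z : H} (h : (x, z) ∈ graphClosure D) :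
    (T x, T z - T x) ∈ graphClosure D := by
  let K : H × H →L[ℂ] H × H := (T.comp (ContinuousLinearMap.fst ℂ H H)).prod
    (T.comp (ContinuousLinearMap.snd ℂ H H) - T.comp (ContinuousLinearMap.fst ℂ H H))
  refine map_mem_graphClosure K (fun y => ?_) h
  have h1 := mem_graphClosure D (nilOp T y)
  have h2 : D (nilOp T y) = nilOp T (D y) - nilOp T y := by
    have := LinearMap.congr_fun hDT y
    simp only [LinearMap.sub_apply, Module.End.mul_apply, LinearMap.neg_apply] at this
    rw [sub_eq_iff_eq_add] at this
    rw [this]; abel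
  rw [h2] at h1
  exact h1

section Complete

variable [CompleteSpace H] {n : ℕ}

/-- A densely defined symmetric operator is closable: if (0, w) is in the closed graph, then w is
orthogonal to the dense domain. -/
theorem eq_of_mem_graphClosure {D : Module.End ℂ (nilSpace T)} (hD : FormalAdj D D)
    (hdense : (nilSpace T).topologicalClosure = ⊤) {x z z' : H} (h : (x, z) ∈ graphClosure D)
    (h' : (x, z') ∈ graphClosure D) : z = z' := by
  have h1 : ((0 : H), z - z') ∈ graphClosure D := by
    have := Submodule.sub_mem _ h h'
    rwa [Prod.mk_sub_mk, sub_self] at this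
  have h2 : z - z' ∈ (nilSpace T)ᗮ := by
    rw [Submodule.mem_orthogonal]
    intro y hy
    have := inner_graphClosure hD (mem_graphClosure D ⟨y, hy⟩) h1
    rw [inner_zero_right] at this
    exact this.symm
  rw [Submodule.topologicalClosure_eq_top_iff.1 hdense, Submodule.mem_bot] at h2
  exact sub_eq_zero.1 h2

/-- The generalised eigenvectors of `T` for small eigenvalues are in the domain of the closure of
a grading operator. -/
theorem exists_mem_graphClosure {D : Module.End ℂ (nilSpace T)} (hD : FormalAdj D D)
    (hDT : D * nilOp T - nilOp T * D = -nilOp T) (hT : Function.Surjective T) :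
    ∃ ε > 0, ∀ q : ℂ, ‖q‖ < ε → ∀ (k : ℕ) (x : H), ((T - q • (1 : H →L[ℂ] H)) ^ k) x = 0 →
      ∃ z, (x, z) ∈ graphClosure D := by
  obtain ⟨R, hTR, hR⟩ := exists_rightInverse hT
  have hRV : ∀ x ∈ nilSpace T, R x ∈ nilSpace T := by
    rintro x ⟨k, hk⟩
    exact ⟨k + 1, by rw [pow_succ, mul_apply_eq_comp, hTR, hk]⟩
  have hinj : ∀ x, (∀ y, T y = 0 → inner ℂ y x = 0) → T x = 0 → x = 0 := fun x hx hTx =>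
    inner_self_eq_zero.1 (hx x hTx)
  have hDTx : ∀ y, nilOp T (D y) = D (nilOp T y) + nilOp T y := by
    intro y
    have := LinearMap.congr_fun hDT y
    simp only [LinearMap.sub_apply, Module.End.mul_apply, LinearMap.neg_apply] at this
    rw [sub_eq_iff_eq_add] at this
    rw [this]; abel
  -- Both sides have the same image under T. Their difference is orthogonal to ker T, since D is
  -- symmetric and preserves ker T and R has range orthogonal to it.
  have hDR : ∀ x : nilSpace T, (D ⟨R x, hRV x x.2⟩ : H) = R (D x) + R x := by
    intro x
    have hTx : nilOp T ⟨R x, hRV x x.2⟩ = x := Subtype.ext (hTR x)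
    have h1 := congrArg Subtype.val (hDTx ⟨R x, hRV x x.2⟩)
    rw [hTx] at h1
    have h2 : T (D ⟨R x, hRV x x.2⟩ : H) = (D x : H) + x := h1
    refine sub_eq_zero.1 (hinj _ ?_ (by rw [map_sub, map_add, hTR, hTR, h2, sub_self]))
    intro y hy
    have hyV : y ∈ nilSpace T := ⟨1, by simpa using hy⟩
    have hDy : T (D ⟨y, hyV⟩ : H) = 0 := by
      have h3 := congrArg Subtype.val (hDTx ⟨y, hyV⟩)
      have h4 : nilOp T ⟨y, hyV⟩ = 0 := Subtype.ext hy
      rw [h4, map_zero, add_zero] at h3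
      exact h3
    have h5 : inner ℂ (D ⟨y, hyV⟩ : H) (R x) = inner ℂ y (D ⟨R x, hRV x x.2⟩ : H) :=
      hD ⟨y, hyV⟩ ⟨R x, hRV x x.2⟩
    rw [inner_sub_right, inner_add_right, hR _ _ hy, hR _ _ hy, ← h5, hR _ _ hDy]
    simp
  let K : H × H →L[ℂ] H × H := (R.comp (ContinuousLinearMap.fst ℂ H H)).prod
    (R.comp (ContinuousLinearMap.snd ℂ H H) + R.comp (ContinuousLinearMap.fst ℂ H H))
  have hK : ∀ p ∈ graphClosure D, K p ∈ graphClosure D := fun p hp => by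
    refine map_mem_graphClosure K (fun y => ?_) hp
    have h1 := mem_graphClosure D ⟨R y, hRV y y.2⟩
    rw [hDR] at h1
    exact h1
  -- This radius makes both qK and qR strict contractions. K, the action of R on the graph,
  -- preserves the closed graph, so Neumann series for qK stay inside it.
  refine ⟨(‖K‖ + ‖R‖ + 1)⁻¹, by positivity, fun q hq => ?_⟩
  have hq1 : ‖q‖ * (‖K‖ + ‖R‖ + 1) < 1 := by
    rwa [← one_div, lt_div_iff₀ (by positivity)] at hq
  have hqK : ‖q • K‖ < 1 := by
    refine (ContinuousLinearMap.opNorm_smul_le q K).trans_lt (lt_of_le_of_lt ?_ hq1)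
    gcongr
    linarith [norm_nonneg R]
  have hqR : ‖q • R‖ < 1 := by
    rw [norm_smul]
    refine lt_of_le_of_lt ?_ hq1
    gcongr
    linarith [norm_nonneg K]
  intro k
  induction k with
  | zero =>
    intro x hx
    have hx0 : x = 0 := by simpa using hx
    exact ⟨0, by rw [hx0]; exact Submodule.zero_mem _⟩
  | succ k ih =>
    intro x hx
    obtain ⟨y, hy⟩ : ∃ y, y = (T - q • (1 : H →L[ℂ] H)) x := ⟨_, rfl⟩
    rw [pow_succ, mul_apply_eq_comp, ← hy] at hx
    obtain ⟨z, hz⟩ := ih y hx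
    obtain ⟨p, hp⟩ : ∃ p, p = x - q • R x := ⟨_, rfl⟩
    have hTp : T p = y := by
      rw [hp, hy, map_sub, map_smul, hTR]
      rfl
    -- Here p = x - qRx and Tp = y, so p differs from Ry by an element of ker T. Thus p is in the
    -- domain, and solving x - qRx = p on the graph puts x there too.
    have hpV : p - R y ∈ nilSpace T := ⟨1, by rw [pow_one, map_sub, hTp, hTR, sub_self]⟩
    have h1 := Submodule.add_mem _ (mem_graphClosure D ⟨_, hpV⟩) (hK _ hz)
    have h2 := exists_sub_eq_of_invariant hqK (Submodule.isClosed_topologicalClosure _)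
      (fun p hp => Submodule.smul_mem _ q (hK p hp)) h1
    obtain ⟨⟨x', z'⟩, hx', he⟩ := h2
    have he1 : x' - q • R x' = p - R y + R y := congrArg Prod.fst he
    rw [sub_add_cancel, hp] at he1
    have hxx : x' = x := by
      have h3 : x' - x - (q • R) (x' - x) = 0 := by
        rw [map_sub, sub_sub_sub_comm]
        exact sub_eq_zero.2 he1
      have h4 : ‖x' - x‖ ≤ ‖q • R‖ * ‖x' - x‖ := by
        conv_lhs => rw [sub_eq_zero.1 h3]
        exact (q • R).le_opNorm _
      have h5 : ‖x' - x‖ ≤ 0 := by nlinarith [norm_nonneg (x' - x)]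
      exact sub_eq_zero.1 (norm_le_zero_iff.1 h5)
    exact ⟨z', hxx ▸ hx'⟩

/-- The bracket of D with T - q is -T, which preserves but need not lower the order of a generalised
eigenvector when q ≠ 0; hence the extra power. -/
theorem pow_apply_eq_zero_of_mem_graphClosure {D : Module.End ℂ (nilSpace T)} (hD : FormalAdj D D)
    (hdense : (nilSpace T).topologicalClosure = ⊤)
    (hDT : D * nilOp T - nilOp T * D = -nilOp T) (q : ℂ) (k : ℕ) {x z : H}
    (hx : ((T - q • (1 : H →L[ℂ] H)) ^ k) x = 0) (h : (x, z) ∈ graphClosure D) :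
    ((T - q • (1 : H →L[ℂ] H)) ^ (k + 1)) z = 0 := by
  induction k generalizing x z with
  | zero =>
    have hx0 : x = 0 := by simpa using hx
    rw [hx0] at h
    rw [eq_of_mem_graphClosure hD hdense h (Submodule.zero_mem _), map_zero]
  | succ k ih =>
    have hcomm : Commute (T - q • (1 : H →L[ℂ] H)) T :=
      (Commute.refl T).sub_left ((Commute.one_left T).smul_left q)
    have h1 : ((T - q • (1 : H →L[ℂ] H)) x, (T - q • (1 : H →L[ℂ] H)) z - T x)
        ∈ graphClosure D := by
      have := Submodule.sub_mem _ (T_mem_graphClosure hDT h) (Submodule.smul_mem _ q h)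
      convert this using 1
      refine Prod.ext rfl ?_
      change T z - q • z - T x = T z - T x - q • z
      abel
    rw [pow_succ, mul_apply_eq_comp] at hx
    have h2 := ih hx h1
    have h3 : ((T - q • (1 : H →L[ℂ] H)) ^ (k + 1)) (T x) = 0 := by
      rw [← mul_apply_eq_comp, (hcomm.pow_left (k + 1)).eq, mul_apply_eq_comp, pow_succ,
        mul_apply_eq_comp, hx, map_zero]
    rw [map_sub, h3, sub_zero] at h2
    rw [pow_succ, mul_apply_eq_comp, h2]

end Complete

end Closure

end HomogeneousCD

/-! ### Generators from the Möbius action -/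

namespace HomogeneousCD

section Moebius

/-- Subtracting rD removes the term linear in T, because [D, T] = -T. -/
theorem exists_rescaled_generator {E : Type*} [NormedAddCommGroup E] [InnerProductSpace ℂ E]
    {T D X : Module.End ℂ E} (hD : FormalAdj D D) (hX : FormalAdj X X)
    (hDT : D * T - T * D = -T) {c r : ℝ} (hc : c ≠ 0)
    (hXT : X * T - T * X = (c : ℂ) • 1 - (r : ℂ) • T + (c : ℂ) • (T * T)) :
    ∃ X' : Module.End ℂ E, FormalAdj X' X' ∧ X' * T - T * X' = 1 + T * T := by
  refine ⟨((c⁻¹ : ℝ) : ℂ) • (X - (r : ℂ) • D), (hX.sub (hD.smul_real _)).smul_real _, ?_⟩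
  have h1 : (X - (r : ℂ) • D) * T - T * (X - (r : ℂ) • D) = (c : ℂ) • (1 + T * T) := by
    rw [sub_mul, mul_sub, smul_mul_assoc, mul_smul_comm, sub_sub_sub_comm, hXT, ← smul_sub, hDT]
    module
  have hc' : (c : ℂ) ≠ 0 := by exact_mod_cast hc
  rw [smul_mul_assoc, mul_smul_comm, ← smul_sub, h1, smul_smul, Complex.ofReal_inv,
    inv_mul_cancel₀ hc', one_smul]

variable {H : Type*} [NormedAddCommGroup H] [InnerProductSpace ℂ H] [CompleteSpace H]
  {T : H →L[ℂ] H} {n : ℕ}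

theorem inner_apply_eq_inner_star (U : H →L[ℂ] H) (x y : H) :
    inner ℂ (U x) y = inner ℂ x (star U y) := by
  rw [ContinuousLinearMap.star_eq_adjoint, ContinuousLinearMap.adjoint_inner_right]

/-- The rotation attached to a = c, b = 0 is T ↦ c²T, so it is c² that must not be a root of unity.
Here c² = e^i, and irrationality of π applies. -/
theorem exists_unit_not_root_of_unity : ∃ c : ℂ, ‖c‖ = 1 ∧ ∀ k : ℤ, (c * c) ^ k = 1 → k = 0 := by
  refine ⟨Complex.exp ((1 / 2 : ℝ) * Complex.I), Complex.norm_exp_ofReal_mul_I _, fun k hk => ?_⟩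
  rw [← Complex.exp_add, ← Complex.exp_int_mul, Complex.exp_eq_one_iff] at hk
  obtain ⟨m, hm⟩ := hk
  have h1 : (k : ℂ) = m * (2 * Real.pi) := by
    refine mul_right_cancel₀ Complex.I_ne_zero ?_
    linear_combination (norm := (push_cast; ring)) hm
  have h2 : (k : ℝ) = m * (2 * Real.pi) := by exact_mod_cast h1
  by_cases hm0 : m = 0
  · rw [hm0] at h2
    simpa using h2
  · exfalso
    refine irrational_pi ⟨(k : ℚ) / (2 * m), ?_⟩
    push_cast
    have hm' : (m : ℝ) ≠ 0 := by exact_mod_cast hm0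
    rw [h2]
    field_simp

theorem IsCowenDouglas.exists_grading (hCD : IsCowenDouglas n (Metric.ball (0 : ℂ) 1) T)
    (hT : IsHomogeneous T) :
    ∃ D : Module.End ℂ (nilSpace T), FormalAdj D D ∧ D * nilOp T - nilOp T * D = -nilOp T := by
  obtain ⟨c, hc, hroot⟩ := exists_unit_not_root_of_unity
  have hc0 : c ≠ 0 := by rintro rfl; simp at hc
  have hcc : conj c * c = 1 := by
    rw [mul_comm, Complex.mul_conj, Complex.normSq_eq_norm_sq, hc]; simp
  obtain ⟨U, hU, hUT⟩ := hT.2 c 0 (by rw [hc]; simp)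
  have hmob : mobius c 0 T = (c * c) • T := by
    have h1 : (conj c • (1 : H →L[ℂ] H)) * (c • 1) = 1 := by
      rw [smul_mul_smul_comm, hcc, one_smul, one_mul]
    have h2 : (c • (1 : H →L[ℂ] H)) * (conj c • 1) = 1 := by
      rw [smul_mul_smul_comm, mul_comm c, hcc, one_smul, one_mul]
    have h3 : Ring.inverse (conj c • (1 : H →L[ℂ] H)) = c • 1 :=
      Ring.inverse_unit ⟨conj c • 1, c • 1, h1, h2⟩
    rw [mobius, map_zero, zero_smul, zero_smul, zero_add, add_zero, h3, smul_mul_smul_comm, mul_one]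
  have hTU : ∀ x, T (U x) = (c * c) • U (T x) := by
    have h1 : T * U = (c * c) • (U * T) := by
      have h2 : U * (star U * T * U) = U * mobius c 0 T := by rw [hUT]
      rw [← mul_assoc, ← mul_assoc, (Unitary.mem_iff.1 hU).2, one_mul, hmob, mul_smul_comm] at h2
      exact h2
    exact fun x => DFunLike.congr_fun h1 x
  have hTk : ∀ (k : ℕ) x, (T ^ k) (U x) = (c * c) ^ k • U ((T ^ k) x) := by
    intro k
    induction k with
    | zero => intro x; simp
    | succ k ih =>
      intro x
      rw [pow_succ, mul_apply_eq_comp, hTU, map_smul, ih, mul_apply_eq_comp, smul_smul,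
        ← pow_succ']
  let u : Module.End ℂ (nilSpace T) := (U : H →ₗ[ℂ] H).restrict fun x hx => by
    obtain ⟨k, hk⟩ := hx
    exact ⟨k, by
      change (T ^ k) (U x) = 0
      rw [hTk, hk, map_zero, smul_zero]⟩
  have := hCD.finiteDimensional_ker_nilOp
  refine HomogeneousCD.exists_grading (u := u) nilOp_nil (fun x y => ?_) (mul_ne_zero hc0 hc0) hroot ?_
  · change inner ℂ (U x) (U y) = inner ℂ (x : H) (y : H)
    rw [inner_apply_eq_inner_star U, ← mul_apply_eq_comp, (Unitary.mem_iff.1 hU).1]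
    rfl
  · exact LinearMap.ext fun x => Subtype.ext (hTU x)

/-- The unitary U* carries ker T^k to ker g(T)^k = ker(T - q)^k, where q is the zero of g. For small
q these vectors lie in the domain of the closure of D, so X = U D U* (with D closed) is defined on V
and preserves it. -/
theorem IsCowenDouglas.exists_hyperbolic (hCD : IsCowenDouglas n (Metric.ball (0 : ℂ) 1) T)
    (hT : IsHomogeneous T) {D : Module.End ℂ (nilSpace T)} (hD : FormalAdj D D)
    (hDT : D * nilOp T - nilOp T * D = -nilOp T) :
    ∃ X : Module.End ℂ (nilSpace T), FormalAdj X X ∧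
      X * nilOp T - nilOp T * X = 1 + nilOp T * nilOp T := by
  have hdense := hCD.dense_nilSpace
  have hsurj : Function.Surjective T := by
    have := hCD.surjective (w₀ := 0) (by simp)
    rwa [zero_smul, sub_zero] at this
  obtain ⟨ε, hε, hdom⟩ := exists_mem_graphClosure hD hDT hsurj
  -- Since a ≥ 1, choosing b < ε makes |q| = b/a < ε.
  obtain ⟨b, hb0, hbε⟩ := exists_between hε
  obtain ⟨a, ha⟩ : ∃ a, a = √(1 + b ^ 2) := ⟨_, rfl⟩
  have ha2 : a ^ 2 = 1 + b ^ 2 := by rw [ha, Real.sq_sqrt (by positivity)]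
  have ha1 : 1 ≤ a := by rw [ha, Real.one_le_sqrt]; nlinarith
  have ha0 : 0 < a := by linarith
  have hac : (a : ℂ) ≠ 0 := by exact_mod_cast ha0.ne'
  have hbc : (b : ℂ) ≠ 0 := by exact_mod_cast hb0.ne'
  have ha2c : (a : ℂ) ^ 2 = 1 + (b : ℂ) ^ 2 := by exact_mod_cast ha2
  have hab : ‖(a : ℂ)‖ ^ 2 - ‖(b : ℂ)‖ ^ 2 = 1 := by
    rw [Complex.norm_real, Complex.norm_real, Real.norm_eq_abs, Real.norm_eq_abs, sq_abs, sq_abs,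
      ha2]; ring
  obtain ⟨U, hU, hUT⟩ := hT.2 a b hab
  have hunit := isUnit_mobius_denominator hT.1 hab
  obtain ⟨G, hG⟩ : ∃ G, G = mobius a b T := ⟨_, rfl⟩
  obtain ⟨C, hC⟩ : ∃ C, C = (b : ℂ) • T + (a : ℂ) • (1 : H →L[ℂ] H) := ⟨_, rfl⟩
  obtain ⟨N, hN⟩ : ∃ N, N = (a : ℂ) • T + (b : ℂ) • (1 : H →L[ℂ] H) := ⟨_, rfl⟩
  rw [← hG] at hUT
  rw [Complex.conj_ofReal, Complex.conj_ofReal, ← hC] at hunit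
  have hGN : G = N * Ring.inverse C := by
    rw [hG, mobius, Complex.conj_ofReal, Complex.conj_ofReal, ← hC, ← hN]
  have hNC : Commute N C := by
    rw [hN, hC]
    exact (((Commute.refl T).smul_right _).add_right ((Commute.one_right T).smul_right _)).smul_left _
      |>.add_left (((Commute.one_left T).smul_right _ |>.add_right
        ((Commute.refl (1 : H →L[ℂ] H)).smul_right _)).smul_left _)
  have hCG : C * G = N := by
    rw [hGN, ← mul_assoc, ← hNC.eq, mul_assoc, Ring.mul_inverse_cancel _ hunit, mul_one]
  have hGC : G * C = N := by
    rw [hGN, mul_assoc, Ring.inverse_mul_cancel _ hunit, mul_one]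
  have hCinj : ∀ {x y : H}, C x = C y → x = y := by
    intro x y hxy
    have h1 := congrArg (fun v => (Ring.inverse C : H →L[ℂ] H) v) hxy
    change (Ring.inverse C : H →L[ℂ] H) (C x) = (Ring.inverse C : H →L[ℂ] H) (C y) at h1
    rwa [← mul_apply_eq_comp, ← mul_apply_eq_comp, Ring.inverse_mul_cancel _ hunit] at h1
  have hCGcomm : Commute C G := by rw [Commute, SemiconjBy, hCG, hGC]
  have hpow : ∀ k : ℕ, N ^ k = C ^ k * G ^ k := fun k => by
    rw [← hCG, hCGcomm.mul_pow]
  have hCkinj : ∀ (k : ℕ) {x : H}, (C ^ k) x = 0 → x = 0 := by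
    intro k
    induction k with
    | zero => intro x hx; simpa using hx
    | succ k ih =>
      intro x hx
      rw [pow_succ, mul_apply_eq_comp] at hx
      exact hCinj ((ih hx).trans (map_zero C).symm)
  have hGk : ∀ (k : ℕ) (x : H), (G ^ k) x = 0 ↔ (N ^ k) x = 0 := by
    intro k x
    rw [hpow, mul_apply_eq_comp]
    exact ⟨fun h => by rw [h, map_zero], fun h => hCkinj k h⟩
  obtain ⟨q, hq⟩ : ∃ q : ℂ, q = -((b : ℂ) / a) := ⟨_, rfl⟩
  have hNq : ∀ (k : ℕ) (x : H), (N ^ k) x = 0 ↔ ((T - q • (1 : H →L[ℂ] H)) ^ k) x = 0 := by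
    intro k x
    have h1 : N = (a : ℂ) • (T - q • (1 : H →L[ℂ] H)) := by
      rw [hN, hq, smul_sub, smul_smul, mul_neg, mul_div_cancel₀ _ hac, neg_smul, sub_neg_eq_add]
    rw [h1, smul_pow]
    change (a : ℂ) ^ k • ((T - q • (1 : H →L[ℂ] H)) ^ k) x = 0 ↔ _
    rw [smul_eq_zero, or_iff_right (pow_ne_zero k hac)]
  have hqε : ‖q‖ < ε := by
    rw [hq, norm_neg, norm_div, Complex.norm_real, Complex.norm_real, Real.norm_eq_abs,
      Real.norm_eq_abs, abs_of_pos hb0, abs_of_pos ha0]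
    exact (div_le_self hb0.le ha1).trans_lt hbε
  have hUU : ∀ x, U (star U x) = x := fun x => DFunLike.congr_fun (Unitary.mem_iff.1 hU).2 x
  have hUU' : ∀ x, star U (U x) = x := fun x => DFunLike.congr_fun (Unitary.mem_iff.1 hU).1 x
  have hTU : ∀ x, T (U x) = U (G x) := fun x => by
    rw [← hUT, mul_apply_eq_comp, mul_apply_eq_comp, hUU]
  have hUsT : ∀ x, star U (T x) = G (star U x) := fun x => by
    rw [← hUT, mul_apply_eq_comp, mul_apply_eq_comp, hUU]
  have hTkU : ∀ (k : ℕ) x, (T ^ k) (U x) = U ((G ^ k) x) := by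
    intro k
    induction k with
    | zero => intro x; simp
    | succ k ih => intro x; rw [pow_succ, mul_apply_eq_comp, hTU, ih, pow_succ, mul_apply_eq_comp]
  -- the transported operator
  have hex : ∀ x : nilSpace T, ∃ z : nilSpace T, (star U (x : H), star U (z : H)) ∈ graphClosure D := by
    intro x
    obtain ⟨k, hk⟩ := x.2
    have h1 : (G ^ k) (star U (x : H)) = 0 := by
      have h2 := hTkU k (star U (x : H))
      rw [hUU, hk] at h2
      rw [← hUU' ((G ^ k) _), ← h2, map_zero]
    have h3 := (hNq k _).1 ((hGk k _).1 h1)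
    obtain ⟨z, hz⟩ := hdom q hqε k _ h3
    have h4 := pow_apply_eq_zero_of_mem_graphClosure hD hdense hDT q k h3 hz
    have h5 := (hGk (k + 1) _).2 ((hNq (k + 1) _).2 h4)
    refine ⟨⟨U z, k + 1, by rw [hTkU, h5, map_zero]⟩, ?_⟩
    change (star U (x : H), star U (U z)) ∈ _
    rwa [hUU']
  choose X₀ hX₀ using hex
  have huniq : ∀ {x z : nilSpace T}, (star U (x : H), star U (z : H)) ∈ graphClosure D →
      X₀ x = z := by
    intro x z hz
    have h1 := eq_of_mem_graphClosure hD hdense (hX₀ x) hz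
    refine Subtype.ext ?_
    rw [← hUU (X₀ x : H), h1, hUU]
  let X : Module.End ℂ (nilSpace T) :=
    { toFun := X₀
      map_add' := fun x y => huniq (by
        have := Submodule.add_mem _ (hX₀ x) (hX₀ y)
        rw [Prod.mk_add_mk, ← map_add, ← map_add] at this
        exact this)
      map_smul' := fun c x => huniq (by
        have := Submodule.smul_mem _ c (hX₀ x)
        rw [Prod.smul_mk, ← map_smul, ← map_smul] at this
        exact this) }
  have hX : FormalAdj X X := by
    intro x y
    have h1 := inner_graphClosure hD (hX₀ x) (hX₀ y)
    simp only at h1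
    rw [← inner_apply_eq_inner_star U, hUU, ← inner_apply_eq_inner_star U, hUU] at h1
    exact h1
  -- Formally [D, g(T)] = -T g'(T), and with w = g(z) one has -z g'(z) = ab - (a² + b²)w + abw². The
  -- proof clears the denominator C so that only polynomials in T meet the closed graph.
  have hXT : X * nilOp T - nilOp T * X = ((a : ℂ) * b) • 1 - ((a : ℂ) ^ 2 + (b : ℂ) ^ 2) • nilOp T
      + ((a : ℂ) * b) • (nilOp T * nilOp T) := by
    refine LinearMap.ext fun x => Subtype.ext ?_
    obtain ⟨ξ, hξ⟩ : ∃ ξ, ξ = star U (x : H) := ⟨_, rfl⟩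
    obtain ⟨z, hz⟩ : ∃ z, z = star U (X₀ x : H) := ⟨_, rfl⟩
    obtain ⟨z₂, hz₂⟩ : ∃ z₂, z₂ = star U (X₀ (nilOp T x) : H) := ⟨_, rfl⟩
    have hxU : (x : H) = U ξ := by rw [hξ, hUU]
    have hzU : (X₀ x : H) = U z := by rw [hz, hUU]
    have hz₂U : (X₀ (nilOp T x) : H) = U z₂ := by rw [hz₂, hUU]
    have m1 : (ξ, z) ∈ graphClosure D := by rw [hξ, hz]; exact hX₀ x
    have m2 : (G ξ, z₂) ∈ graphClosure D := by
      have := hX₀ (nilOp T x)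
      rwa [coe_nilOp, hUsT, ← hξ, ← hz₂] at this
    have mC : (C (G ξ), C z₂ - (b : ℂ) • T (G ξ)) ∈ graphClosure D := by
      have h1 := Submodule.add_mem _ (Submodule.smul_mem _ (b : ℂ) (T_mem_graphClosure hDT m2))
        (Submodule.smul_mem _ (a : ℂ) m2)
      convert h1 using 1
      rw [hC]
      refine Prod.ext rfl ?_
      change (b : ℂ) • T z₂ + (a : ℂ) • z₂ - (b : ℂ) • T (G ξ)
        = (b : ℂ) • (T z₂ - T (G ξ)) + (a : ℂ) • z₂
      module
    have mN : (N ξ, N z - (a : ℂ) • T ξ) ∈ graphClosure D := by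
      have h1 := Submodule.add_mem _ (Submodule.smul_mem _ (a : ℂ) (T_mem_graphClosure hDT m1))
        (Submodule.smul_mem _ (b : ℂ) m1)
      convert h1 using 1
      rw [hN]
      refine Prod.ext rfl ?_
      change (a : ℂ) • T z + (b : ℂ) • z - (a : ℂ) • T ξ
        = (a : ℂ) • (T z - T ξ) + (b : ℂ) • z
      module
    rw [← mul_apply_eq_comp, hCG] at mC
    have h2 := eq_of_mem_graphClosure hD hdense mC mN
    have h3 : ∀ v, T v = C (a • G v - b • v) := by
      intro v
      have e1 : C (a • G v - b • v) = (a : ℂ) • N v - (b : ℂ) • C v := by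
        rw [map_sub, ← hCG, mul_apply_eq_comp]
        rw [← Complex.coe_smul, ← Complex.coe_smul, map_smul, map_smul]
      rw [e1, hN, hC]
      change T v = (a : ℂ) • ((a : ℂ) • T v + (b : ℂ) • v) - (b : ℂ) • ((b : ℂ) • T v + (a : ℂ) • v)
      have e2 : T v = ((a : ℂ) ^ 2 - (b : ℂ) ^ 2) • T v := by
        rw [ha2c, add_sub_cancel_right, one_smul]
      exact e2.trans (by module)
    have h4 : z₂ = G z + (((a : ℂ) * b) • ξ - ((a : ℂ) ^ 2 + (b : ℂ) ^ 2) • G ξ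
        + ((a : ℂ) * b) • G (G ξ)) := by
      apply hCinj
      have e0 : C z₂ = N z - (a : ℂ) • T ξ + (b : ℂ) • T (G ξ) := by
        rw [← h2]; abel
      rw [e0, h3 ξ, h3 (G ξ), map_add, ← mul_apply_eq_comp C G z, hCG, ← Complex.coe_smul,
        ← Complex.coe_smul, ← Complex.coe_smul, ← Complex.coe_smul]
      simp only [map_sub, map_add, map_smul]
      module
    change (X₀ (nilOp T x) : H) - T (X₀ x : H) = ((a : ℂ) * b) • (x : H)
      - ((a : ℂ) ^ 2 + (b : ℂ) ^ 2) • T (x : H) + ((a : ℂ) * b) • T (T (x : H))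
    rw [hz₂U, hzU, hxU, hTU, hTU, hTU, h4, map_add, add_sub_cancel_left, map_add, map_sub, map_smul,
      map_smul, map_smul]
  refine exists_rescaled_generator hD hX hDT (c := a * b) (r := a ^ 2 + b ^ 2)
    (mul_pos ha0 hb0).ne' ?_
  rw [hXT]
  push_cast
  rfl

end Moebius

end HomogeneousCD

/-! ### Extension to the Hilbert space and the dichotomy -/

namespace HomogeneousCD

section Similarity

variable {H : Type*} [NormedAddCommGroup H] [InnerProductSpace ℂ H] {T : H →L[ℂ] H} {n : ℕ}

theorem IsSimilarToContraction.isPowerBounded (h : IsSimilarToContraction T) :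
    IsPowerBounded T := by
  obtain ⟨X, hX⟩ := h
  refine ⟨‖((X⁻¹ : (H →L[ℂ] H)ˣ) : H →L[ℂ] H)‖ * ‖(X : H →L[ℂ] H)‖, fun k => ?_⟩
  have h1 : T ^ k = ((X⁻¹ : (H →L[ℂ] H)ˣ) : H →L[ℂ] H)
      * ((X : H →L[ℂ] H) * T * ((X⁻¹ : (H →L[ℂ] H)ˣ) : H →L[ℂ] H)) ^ k * X := by
    rw [Units.conj_pow]
    simp [mul_assoc]
  have h2 : ∀ k : ℕ, ‖((X : H →L[ℂ] H) * T * ((X⁻¹ : (H →L[ℂ] H)ˣ) : H →L[ℂ] H)) ^ k‖ ≤ 1 := by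
    intro k
    induction k with
    | zero => rw [pow_zero]; exact ContinuousLinearMap.norm_id_le
    | succ k ih =>
      rw [pow_succ]
      exact (norm_mul_le _ _).trans (mul_le_one₀ ih (norm_nonneg _) hX)
  rw [h1]
  calc _ ≤ ‖((X⁻¹ : (H →L[ℂ] H)ˣ) : H →L[ℂ] H)
      * ((X : H →L[ℂ] H) * T * ((X⁻¹ : (H →L[ℂ] H)ˣ) : H →L[ℂ] H)) ^ k‖ * ‖(X : H →L[ℂ] H)‖ :=
        norm_mul_le _ _
    _ ≤ ‖((X⁻¹ : (H →L[ℂ] H)ˣ) : H →L[ℂ] H)‖ * 1 * ‖(X : H →L[ℂ] H)‖ := by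
        gcongr
        exact (norm_mul_le _ _).trans (by gcongr; exact h2 k)
    _ = _ := by rw [mul_one]

theorem IsPolynomiallyBounded.isPowerBounded (h : IsPolynomiallyBounded T) :
    IsPowerBounded T := by
  obtain ⟨C, hC⟩ := h
  refine ⟨|C|, fun k => ?_⟩
  have h1 := hC (Polynomial.X ^ k)
  rw [map_pow, Polynomial.aeval_X] at h1
  obtain ⟨s, hs⟩ : ∃ s, s = sSup ((fun z : ℂ => ‖(Polynomial.X ^ k : Polynomial ℂ).eval z‖) ''
    Metric.closedBall 0 1) := ⟨_, rfl⟩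
  rw [← hs] at h1
  have hs0 : 0 ≤ s := by
    rw [hs]
    refine Real.sSup_nonneg ?_
    rintro _ ⟨z, -, rfl⟩
    exact norm_nonneg _
  have hs1 : s ≤ 1 := by
    rw [hs]
    refine Real.sSup_le ?_ zero_le_one
    rintro _ ⟨z, hz, rfl⟩
    simp only [Polynomial.eval_pow, Polynomial.eval_X, norm_pow]
    exact pow_le_one₀ (norm_nonneg _) (by simpa using hz)
  calc ‖T ^ k‖ ≤ C * s := h1
    _ ≤ |C| * s := by gcongr; exact le_abs_self C
    _ ≤ |C| * 1 := by gcongr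
    _ = |C| := mul_one _

/-- A bounded operator on a dense subspace extends to the whole space. -/
theorem exists_extension [CompleteSpace H] {V : Submodule ℂ H} (hV : V.topologicalClosure = ⊤)
    (A : Module.End ℂ V) {C : ℝ} (hA : ∀ x, ‖A x‖ ≤ C * ‖x‖) :
    ∃ A' : H →L[ℂ] H, ∀ x : V, A' x = A x := by
  let A₀ : V →L[ℂ] H := V.subtypeL.comp (A.mkContinuous C hA)
  have hdr : DenseRange V.subtypeL := by
    have := (Submodule.dense_iff_topologicalClosure_eq_top).2 hV
    simpa [DenseRange] using this
  have hui : IsUniformInducing V.subtypeL := isUniformEmbedding_subtype_val.isUniformInducing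
  exact ⟨A₀.extend V.subtypeL, fun x => A₀.extend_eq hdr hui x⟩

theorem eq_of_eq_on_dense {V : Submodule ℂ H} (hV : V.topologicalClosure = ⊤) {A B : H →L[ℂ] H}
    (h : ∀ x : V, A x = B x) : A = B := by
  have hd : Dense (V : Set H) := (Submodule.dense_iff_topologicalClosure_eq_top).2 hV
  exact DFunLike.coe_injective (Continuous.ext_on hd A.continuous B.continuous fun x hx => h ⟨x, hx⟩)

theorem IsHomogeneous.exists_covariantTriple [CompleteSpace H] (hT : IsHomogeneous T)
    (hCD : IsCowenDouglas n (Metric.ball (0 : ℂ) 1) T) :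
    ∃ z D L B : Module.End ℂ (nilSpace T), CovariantTriple (nilOp T) z D L B := by
  have hfd := hCD.finiteDimensional_ker_nilOp
  obtain ⟨D₀, hD₀, hDT₀⟩ := hCD.exists_grading hT
  obtain ⟨X, hX, hXT⟩ := hCD.exists_hyperbolic hT hD₀ hDT₀
  obtain ⟨D, L, B, hD, hLB, hDT, hLT, hBT, hDL, hDB, hBL⟩ :=
    exists_sl2_triple nilOp_nil hD₀ hX hDT₀ hXT
  obtain ⟨S, hS⟩ := exists_formalAdj nilOp_nil hD hDT
  exact ⟨-S, D, L, B, hfd, nilOp_nil, by rwa [neg_neg], hD, hLB, hDT, hLT, hBT, hDL, hDB, hBL⟩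

/-- A power bounded homogeneous Cowen-Douglas operator is similar to a contraction. -/
theorem IsPowerBounded.isSimilarToContraction [CompleteSpace H] (hpb : IsPowerBounded T)
    (hCD : IsCowenDouglas n (Metric.ball (0 : ℂ) 1) T) (hT : IsHomogeneous T) :
    IsSimilarToContraction T := by
  obtain ⟨z, D, L, B, h⟩ := hT.exists_covariantTriple hCD
  have hdense := hCD.dense_nilSpace
  have hadj : ∀ x y : nilSpace T, inner ℂ (T x) (y : H) = -inner ℂ (x : H) (z y : H) := by
    intro x y
    have h1 : inner ℂ (T x) (y : H) = inner ℂ (x : H) (((-z) y : nilSpace T) : H) := h.adj_T x y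
    rw [h1, LinearMap.neg_apply, Submodule.coe_neg, inner_neg_right]
  -- By density z is the restriction of -T*; in particular T* preserves V.
  have hz : ∀ y : nilSpace T, (z y : H) = -(ContinuousLinearMap.adjoint T) y := by
    intro y
    have h1 : (z y : H) + (ContinuousLinearMap.adjoint T) y ∈ (nilSpace T)ᗮ := by
      rw [Submodule.mem_orthogonal]
      intro x hx
      rw [inner_add_right, ContinuousLinearMap.adjoint_inner_right, hadj ⟨x, hx⟩ y]
      simp
    rw [Submodule.topologicalClosure_eq_top_iff.1 hdense, Submodule.mem_bot] at h1
    exact eq_neg_of_add_eq_zero_left h1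
  have hhalf : ∀ η v, IsLowest D B η v → v ≠ 0 → 1 / 2 ≤ η := by
    intro η v hv hv0
    by_contra hη
    obtain ⟨C, hC⟩ := hpb
    obtain ⟨k, hk⟩ := h.exists_lt_norm_z_pow (not_le.1 hη) hv hv0 (C * ‖v‖)
    have hzk : ∀ k : ℕ, ((z ^ k) v : H) = (-1 : ℂ) ^ k • ((ContinuousLinearMap.adjoint T) ^ k) v := by
      intro k
      induction k with
      | zero => simp
      | succ k ih =>
        rw [pow_succ', Module.End.mul_apply, hz, ih, map_smul, pow_succ', pow_succ',
          mul_apply_eq_comp, mul_smul, neg_one_smul]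
    have h1 : ‖(z ^ k) v‖ ≤ C * ‖v‖ := by
      rw [← Submodule.norm_coe, hzk, norm_smul, norm_pow, norm_neg, norm_one, one_pow, one_mul]
      refine (ContinuousLinearMap.le_opNorm _ _).trans ?_
      rw [← ContinuousLinearMap.star_eq_adjoint, ← star_pow, norm_star]
      exact mul_le_mul_of_nonneg_right (hC k) (norm_nonneg _)
    exact absurd hk (not_lt.2 h1)
  obtain ⟨Γ, Ψ, C, C', hΓΨ, hΨΓ, hΓ, hΨ, hcontr⟩ := h.exists_similarity hhalf
  obtain ⟨Γ', hΓ'⟩ := exists_extension hdense Γ hΓ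
  obtain ⟨Ψ', hΨ'⟩ := exists_extension hdense Ψ hΨ
  have e1 : Γ' * Ψ' = 1 := eq_of_eq_on_dense hdense fun x => by
    rw [mul_apply_eq_comp, hΨ', hΓ', ← Module.End.mul_apply, hΓΨ]; rfl
  have e2 : Ψ' * Γ' = 1 := eq_of_eq_on_dense hdense fun x => by
    rw [mul_apply_eq_comp, hΓ', hΨ', ← Module.End.mul_apply, hΨΓ]; rfl
  have hnorm : ‖Ψ' * star T * Γ'‖ ≤ 1 := by
    refine ContinuousLinearMap.opNorm_le_bound _ zero_le_one fun x => ?_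
    have hcl : IsClosed {x : H | ‖(Ψ' * star T * Γ') x‖ ≤ 1 * ‖x‖} :=
      isClosed_le (by fun_prop) (by fun_prop)
    have hd : Dense (nilSpace T : Set H) :=
      (Submodule.dense_iff_topologicalClosure_eq_top).2 hdense
    refine (hcl.closure_subset_iff.2 fun y hy => ?_) (hd x)
    have h1 := hcontr ⟨y, hy⟩
    have h2 : (Ψ' * star T * Γ') y = -((Ψ (z (Γ ⟨y, hy⟩)) : nilSpace T) : H) := by
      change Ψ' ((ContinuousLinearMap.adjoint T) (Γ' y)) = _
      rw [← hΨ', hz, map_neg, neg_neg, ← hΓ']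
    change ‖(Ψ' * star T * Γ') y‖ ≤ 1 * ‖y‖
    rw [h2, norm_neg]
    exact h1
  -- The contraction obtained is Ψ' T* Γ'; its adjoint Γ'* T Ψ'* exhibits the similarity for T.
  refine ⟨⟨star Γ', star Ψ', by rw [← star_mul, e2, star_one], by rw [← star_mul, e1, star_one]⟩, ?_⟩
  change ‖star Γ' * T * star Ψ'‖ ≤ 1
  rw [← norm_star]
  simpa [mul_assoc] using hnorm

end Similarity

end HomogeneousCD

theorem mainTheorem11 {H : Type*} [NormedAddCommGroup H] [InnerProductSpace ℂ H]
    [CompleteSpace H] (n : ℕ) (T : H →L[ℂ] H)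
    (hCD : HomogeneousCD.IsCowenDouglas n (Metric.ball (0 : ℂ) 1) T)
    (hT : HomogeneousCD.IsHomogeneous T) :
    Xor (HomogeneousCD.IsSimilarToContraction T) (¬ HomogeneousCD.IsPowerBounded T) ∧
      (HomogeneousCD.IsPolynomiallyBounded T → HomogeneousCD.IsSimilarToContraction T) := by
  refine ⟨?_, fun h => h.isPowerBounded.isSimilarToContraction hCD hT⟩
  by_cases h : HomogeneousCD.IsPowerBounded T
  · exact Or.inl ⟨h.isSimilarToContraction hCD hT, not_not.2 h⟩
  · exact Or.inr ⟨h, fun h' => h h'.isPowerBounded⟩
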